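/- Let $B\in\mathbb R$ and $m\in\mathbb Z^2$, put $m'=m+(\tfrac12,\tfrac12)$, and let $e_1,e_2$ be the unit vectors of $\mathbb Z^2$. For $\alpha\in\mathbb R$ let $A^{B,\alpha}(n,n+e_j)=A_{\rm Sym}(n,n+e_j)+A_{\rm AB}(n,n+e_j)$ with the symmetric gauge of the constant field $B$, $$A_{\rm Sym}(n,n+e_j)=-\tfrac12Bn_2\,\delta_{j,1}+\tfrac12Bn_1\,\delta_{j,2},$$ and the Aharonov–Bohm gauge of a flux tube $\alpha$ through the cell attached to $m$, $$A_{\rm AB}(n,n+e_j)=-\alpha\Big[\arctan\tfrac{n_1+1-m_1'}{n_2-m_2'}-\arctan\tfrac{n_1-m_1'}{n_2-m_2'}\Big]\delta_{j,1}+\alpha\Big[\arctan\tfrac{n_2+1-m_2'}{n_1-m_1'}-\arctan\tfrac{n_2-m_2'}{n_1-m_1'}\Big]\delta_{j,2}.$$ The magnetic translations on $\ell^2(\mathbb Z^2)$ are the unitaries $S_j^{B,\alpha}=\sum_n e^{-\imath A^{B,\alpha}(n-e_j,n)}|n-e_j\rangle\langle n|$, and $F$ is the unitary multiplication operator $$F=-\frac{(X_1-m_1')+\imath(X_2-m_2')}{|(X_1-m_1')+\imath(X_2-m_2')|}.$$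 For $\lambda\in[0,1]$ and $\alpha\in\mathbb R$ consider $$H_\alpha(\lambda)=\sum_{n\in\mathbb Z^2}t_n(\alpha)\,(S_1^{B,\alpha})^{n_1}(S_2^{B,\alpha})^{n_2}+\lambda V,\qquad V=\sum_n v_n|n\rangle\langle n|,$$ where $(v_n)$ is real and bounded and the bounded operators $t_n(\alpha)$ satisfy: $t_n(\alpha)-c_n\mathbf 1$ is compact for some $c_n\in\mathbb C$ not depending on $\alpha$; $\sum_n\|t_n(\alpha)\|<\infty$, and $\lim_{\alpha\to\alpha_0}\sum_n\|t_n(\alpha)-t_n(\alpha_0)\|=0$ for every $\alpha_0$; and $$t_{-n}(\alpha)=(S_2^{B,\alpha})^{-n_2}(S_1^{B,\alpha})^{-n_1}t_n(\alpha)^*(S_2^{B,\alpha})^{n_2}(S_1^{B,\alpha})^{n_1},\qquad Ft_n(\alpha)F^*=t_n(\alpha+1).$$ Suppose that the Fermi level $\mu\in\mathbb R$ satisfies the Gap hypothesis: $\mu\notin\sigma(H_0(1))$, and $\mu\notin\sigma_{\rm ess}(H_0(\lambda))$ for all $\lambda\in[0,1]$. Let $P_\mu(\lambda)=\chi(H_0(\lambda)\le\mu)$.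 Then for every $\lambda\in[0,1]$ the operator $P_\mu(\lambda)FP_\mu(\lambda)$ is Fredholm on $P_\mu(\lambda)\ell^2(\mathbb Z^2)$; the path $\alpha\in[0,1]\mapsto H_\alpha(\lambda)$ is a norm continuous path of self-adjoint operators with a well-defined spectral flow through $\mu$; and $$\mathrm{SF}\big(\alpha\in[0,1]\mapsto H_\alpha(\lambda)\text{ by }\mu\big)=-\,\mathrm{Ind}\big(P_\mu(\lambda)FP_\mu(\lambda)\big),$$ where $\mathrm{Ind}(T)=\dim\ker T-\dim\operatorname{coker}T$. Moreover, this integer does not depend on $\lambda\in[0,1]$. Here $\mathrm{SF}$ counts, with multiplicity, eigenvalues crossing $\mu$ upwards positively and downwards negatively. Precisely: for any $0=\alpha_0\le\dots\le\alpha_N=1$ and $a_1,\dots,a_N>0$ such that for all $\alpha\in[\alpha_{i-1},\alpha_i]$ one has $\mu\pm a_i\notin\sigma(H_\alpha(\lambda))$ and $[\mu-a_i,\mu+a_i]\cap\sigma_{\rm ess}(H_\alpha(\lambda))=\emptyset$, $$\mathrm{SF}=\sum_{i=1}^N\Big(\operatorname{rank}\chi_{[\mu,\mu+a_i]}(H_{\alpha_i}(\lambda))-\operatorname{rank}\chi_{[\mu,\mu+a_i]}(H_{\alpha_{i-1}}(\lambda))\Big);$$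 such data exist, and the value does not depend on them. -/

import Mathlib

open Filter Topology

noncomputable section

/-! ### Fredholm index, essential spectrum, spectral projections, spectral flow -/

section Abstract

variable {E : Type*} [NormedAddCommGroup E] [InnerProductSpace ℂ E]

/-- The index `dim ker T - dim coker T` of a (Fredholm) operator `T`. -/
def fredholmIndex (T : E →L[ℂ] E) : ℤ :=
  (Module.finrank ℂ (LinearMap.ker T.toLinearMap) : ℤ)
    - (Module.finrank ℂ (E ⧸ LinearMap.range T.toLinearMap) : ℤ)

/-- The essential spectrum: all `z` for which `T - z` is not a Fredholm operator. -/
def essSpectrum (T : E →L[ℂ] E) : Set ℂ :=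
  {z : ℂ | ¬ (T - z • (1 : E →L[ℂ] E)).IsFredholm}

/-- The operator `P A P`, regarded as an operator on the subspace `P E = range P`. -/
def compression (P A : E →L[ℂ] E) :
    LinearMap.range P.toLinearMap →L[ℂ] LinearMap.range P.toLinearMap :=
  ((P ∘L A ∘L P) ∘L (LinearMap.range P.toLinearMap).subtypeL).codRestrict
    (LinearMap.range P.toLinearMap) (fun x => ⟨A (P x), rfl⟩)

variable [CompleteSpace E]

/-- The spectral projection `χ_s(T)` of a self-adjoint operator `T`, by functional calculus.
It is used only for sets `s` whose indicator function is continuous on the spectrum of `T`, that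
is, for intervals whose end points are outside the spectrum or are isolated points of it. -/
def spectralProj (T : E →L[ℂ] E) (s : Set ℝ) : E →L[ℂ] E :=
  cfc (p := IsSelfAdjoint) (s.indicator (fun _ => (1 : ℝ))) T

/-- A subdivision `0 = τ 0 ≤ τ 1 ≤ ⋯ ≤ τ N = 1` with numbers `a i > 0` such that, for `s` in
`[τ i, τ (i + 1)]`, the operator `T s` has no essential spectrum in `[μ - a i, μ + a i]` and
`μ ± a i` do not belong to its spectrum. -/
def IsFlowSubdivision (T : ℝ → E →L[ℂ] E) (μ : ℝ) (N : ℕ) (τ a : ℕ → ℝ) : Prop :=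
  τ 0 = 0 ∧ τ N = 1 ∧ ∀ i < N, τ i ≤ τ (i + 1) ∧ 0 < a i ∧
    ∀ s ∈ Set.Icc (τ i) (τ (i + 1)),
      μ - a i ∉ spectrum ℝ (T s) ∧ μ + a i ∉ spectrum ℝ (T s) ∧
        ∀ x ∈ Set.Icc (μ - a i) (μ + a i), (x : ℂ) ∉ essSpectrum (T s)

/-- The number of eigenvalues of `T`, with multiplicity, in `[μ, μ + a]`. -/
def eigenCount (T : E →L[ℂ] E) (μ a : ℝ) : ℤ :=
  (Module.finrank ℂ
    (LinearMap.range (spectralProj T (Set.Icc μ (μ + a))).toLinearMap) : ℤ)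

/-- `HasSpectralFlow T μ k`: the path `s ∈ [0,1] ↦ T s` is a norm continuous path of self-adjoint
operators, and its spectral flow through `μ` (eigenvalues that move upwards across `μ` counted
positively, those that move downwards negatively, with multiplicity) is well defined and equal
to `k`: there are subdivisions as above, and each of them yields the value `k`. -/
def HasSpectralFlow (T : ℝ → E →L[ℂ] E) (μ : ℝ) (k : ℤ) : Prop :=
  ContinuousOn T (Set.Icc 0 1) ∧ (∀ s ∈ Set.Icc (0 : ℝ) 1, IsSelfAdjoint (T s)) ∧
  (∃ (N : ℕ) (τ a : ℕ → ℝ), IsFlowSubdivision T μ N τ a) ∧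
  ∀ (N : ℕ) (τ a : ℕ → ℝ), IsFlowSubdivision T μ N τ a →
    ∑ i ∈ Finset.range N, (eigenCount (T (τ (i + 1))) μ (a i) - eigenCount (T (τ i)) μ (a i)) = k

end Abstract

/-! ### Operators on the lattice -/

/-- The sites of the square lattice. -/
abbrev Site : Type := ℤ × ℤ

/-- The Hilbert space `ℓ²(ℤ²)`. -/
abbrev L2Lattice : Type := lp (fun _ : Site => ℂ) 2

/-- Bounded operators on `ℓ²(ℤ²)`. -/
abbrev LatticeOp : Type := L2Lattice →L[ℂ] L2Lattice

theorem memLp_two_iff (f : Site → ℂ) :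
    Memℓp f 2 ↔ Summable fun n => ‖f n‖ ^ 2 := by
  rw [memℓp_gen_iff (by norm_num)]
  norm_num

theorem l2Lattice_norm_sq (f : L2Lattice) : ‖f‖ ^ 2 = ∑' n, ‖f n‖ ^ 2 := by
  have h := lp.norm_rpow_eq_tsum (p := 2) (by norm_num) f
  norm_num at h
  exact h

theorem memLp_weightedPerm (e : Site ≃ Site) (w : Site → Circle) (f : L2Lattice) :
    Memℓp (fun n => (w n : ℂ) * f (e n)) 2 := by
  rw [memLp_two_iff]
  have h := (memLp_two_iff _).1 (lp.memℓp f)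
  have h' := (e.summable_iff (f := fun n => ‖f n‖ ^ 2)).2 h
  refine h'.congr fun n => ?_
  rw [norm_mul, Circle.norm_coe, one_mul]
  rfl

/-- The unitary operator `(U f)(n) = w(n) f(e(n))`, with phases `w` and a bijection `e`, as a
linear isometric equivalence. -/
def weightedPermEquiv (e : Site ≃ Site) (w : Site → Circle) : L2Lattice ≃ₗᵢ[ℂ] L2Lattice where
  toFun f := ⟨fun n => (w n : ℂ) * f (e n), memLp_weightedPerm e w f⟩
  invFun f := ⟨fun n => (((w (e.symm n))⁻¹ : Circle) : ℂ) * f (e.symm n),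
    memLp_weightedPerm e.symm (fun n => (w (e.symm n))⁻¹) f⟩
  map_add' f g := by
    ext n
    exact mul_add _ _ _
  map_smul' c f := by
    ext n
    simp [mul_left_comm]
  left_inv f := by
    ext n
    simp
  right_inv f := by
    ext n
    simp
  norm_map' f := by
    refine (sq_eq_sq₀ (norm_nonneg _) (norm_nonneg _)).1 ?_
    rw [l2Lattice_norm_sq, l2Lattice_norm_sq, ← e.tsum_eq (fun n => ‖f n‖ ^ 2)]
    refine tsum_congr fun n => ?_
    change ‖(w n : ℂ) * f (e n)‖ ^ 2 = _
    rw [norm_mul, Circle.norm_coe, one_mul]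

/-- The same operator, as an element of the unitary group. -/
def weightedPerm (e : Site ≃ Site) (w : Site → Circle) : unitary LatticeOp :=
  Unitary.linearIsometryEquiv.symm (weightedPermEquiv e w)

theorem weightedPerm_apply (e : Site ≃ Site) (w : Site → Circle) (f : L2Lattice) (n : Site) :
    ((weightedPerm e w : LatticeOp) f) n = (w n : ℂ) * f (e n) := rfl

/-- The multiplication operator `V = ∑ v_n |n⟩⟨n|` by a bounded real function `v`. -/
def potential (v : Site → ℝ) (hv : ∃ C, ∀ n, |v n| ≤ C) : LatticeOp :=
  have hb : ∀ f : L2Lattice, ∀ n, ‖(v n : ℂ) * f n‖ ^ 2 ≤ hv.choose ^ 2 * ‖f n‖ ^ 2 := by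
    intro f n
    rw [norm_mul, mul_pow, Complex.norm_real, Real.norm_eq_abs]
    have h1 := hv.choose_spec n
    have h2 := abs_nonneg (v n)
    gcongr
  have hs : ∀ f : L2Lattice, Summable fun n => ‖f n‖ ^ 2 := fun f =>
    (memLp_two_iff _).1 (lp.memℓp f)
  have hm : ∀ f : L2Lattice, Memℓp (fun n => (v n : ℂ) * f n) 2 := fun f =>
    (memLp_two_iff _).2 (Summable.of_nonneg_of_le (fun n => by positivity) (hb f)
      ((hs f).mul_left _))
  LinearMap.mkContinuous
    { toFun := fun f => ⟨fun n => (v n : ℂ) * f n, hm f⟩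
      map_add' := fun f g => by
        ext n
        exact mul_add _ _ _
      map_smul' := fun c f => by
        ext n
        simp [mul_left_comm] }
    hv.choose (fun f => by
      have h0 : 0 ≤ hv.choose := (abs_nonneg _).trans (hv.choose_spec 0)
      refine (sq_le_sq₀ (norm_nonneg _) (by positivity)).1 ?_
      rw [mul_pow, l2Lattice_norm_sq, l2Lattice_norm_sq, ← tsum_mul_left]
      exact Summable.tsum_le_tsum (hb f) ((memLp_two_iff _).1 (hm f)) ((hs f).mul_left _))

theorem potential_apply (v : Site → ℝ) (hv : ∃ C, ∀ n, |v n| ≤ C) (f : L2Lattice) (n : Site) :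
    (potential v hv f) n = (v n : ℂ) * f n := rfl

/-! ### Magnetic translations with a flux tube

A magnetic potential is given by its values `A j n = A(n, n + e_j)` on the oriented edges; the
index `j = 0` stands for the first and `j = 1` for the second coordinate direction. -/

/-- The unit vectors of `ℤ²`. -/
def unitVec (j : Fin 2) : Site := if j = 0 then (1, 0) else (0, 1)

/-- The symmetric gauge for a constant magnetic field `B`. -/
def symGauge (B : ℝ) (j : Fin 2) (n : Site) : ℝ :=
  if j = 0 then -(1 / 2) * B * (n.2 : ℝ) else (1 / 2) * B * (n.1 : ℝ)

/-- The lattice Aharonov-Bohm gauge for a flux tube `α` through the cell whose lower left corner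
is `m`, hence centered at `m' = m + (1/2, 1/2)`. -/
def abGauge (m : Site) (α : ℝ) (j : Fin 2) (n : Site) : ℝ :=
  let x : ℝ := (n.1 : ℝ) - ((m.1 : ℝ) + 1 / 2)
  let y : ℝ := (n.2 : ℝ) - ((m.2 : ℝ) + 1 / 2)
  if j = 0 then -α * (Real.arctan ((x + 1) / y) - Real.arctan (x / y))
  else α * (Real.arctan ((y + 1) / x) - Real.arctan (y / x))

/-- The magnetic translation `S_j = ∑_n exp(-i A(n - e_j, n)) |n - e_j⟩⟨n|`, that is,
`(S_j f)(n) = exp(-i A(n, n + e_j)) f(n + e_j)`. -/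
def magShift (A : Fin 2 → Site → ℝ) (j : Fin 2) : unitary LatticeOp :=
  weightedPerm (Equiv.addRight (unitVec j)) (fun n => Circle.exp (-(A j n)))

/-- The magnetic translations `S_j^{B,α}` for a constant field `B` and a flux tube `α` at `m`. -/
def fluxShift (B : ℝ) (m : Site) (α : ℝ) (j : Fin 2) : unitary LatticeOp :=
  magShift (fun i n => symGauge B i n + abGauge m α i n) j

/-- The ordered monomial `(S_1^{B,α})^{n₁} (S_2^{B,α})^{n₂}`, for `n ∈ ℤ²`. -/
def fluxMonomial (B : ℝ) (m : Site) (α : ℝ) (n : Site) : unitary LatticeOp :=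
  fluxShift B m α 0 ^ n.1 * fluxShift B m α 1 ^ n.2

/-- The complex number `(n₁ - m'₁) + i (n₂ - m'₂)`, with `m' = m + (1/2, 1/2)`. -/
def relPos (m n : Site) : ℂ :=
  ⟨(n.1 : ℝ) - ((m.1 : ℝ) + 1 / 2), (n.2 : ℝ) - ((m.2 : ℝ) + 1 / 2)⟩

theorem relPos_ne_zero (m n : Site) : relPos m n ≠ 0 := by
  intro h
  have h1 : (n.1 : ℝ) - ((m.1 : ℝ) + 1 / 2) = 0 := congrArg Complex.re h
  have h2 : ((2 * n.1 - 2 * m.1 - 1 : ℤ) : ℝ) = 0 := by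
    push_cast
    linarith
  have h3 : (2 * n.1 - 2 * m.1 - 1 : ℤ) = 0 := by exact_mod_cast h2
  omega

/-- The phase `-z / |z|` at `z = (n₁ - m'₁) + i (n₂ - m'₂)`. -/
def diracPhase (m n : Site) : Circle :=
  ⟨-(relPos m n / (‖relPos m n‖ : ℂ)), by
    have h : ‖relPos m n‖ ≠ 0 := norm_ne_zero_iff.2 (relPos_ne_zero m n)
    rw [Submonoid.unitSphere, Submonoid.mem_mk, Subsemigroup.mem_mk, mem_sphere_zero_iff_norm]
    simp [h]⟩

/-- The unitary multiplication operator `F`, the Dirac phase. -/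
def diracF (m : Site) : unitary LatticeOp :=
  weightedPerm (Equiv.refl Site) (diracPhase m)

/-! ### The Hamiltonians -/

/-- The Hamiltonian
`H_α(lam) = ∑_n t_n(α) (S_1^{B,α})^{n₁} (S_2^{B,α})^{n₂} + lam V`. -/
def hamiltonian (B : ℝ) (m : Site) (t : Site → ℝ → LatticeOp) (v : Site → ℝ)
    (hv : ∃ C, ∀ n, |v n| ≤ C) (α lam : ℝ) : LatticeOp :=
  (∑' n : Site, t n α * (fluxMonomial B m α n : LatticeOp)) + (lam : ℂ) • potential v hv

/-- The assumptions on the hopping amplitudes `t_n(α)`. -/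
structure IsHopping (B : ℝ) (m : Site) (t : Site → ℝ → LatticeOp) : Prop where
  /-- `t_n(α)` is a multiple of the identity, independent of `α`, plus a compact operator. -/
  compact : ∀ n, ∃ c : ℂ, ∀ α, IsCompactOperator (t n α - c • (1 : LatticeOp))
  /-- `∑_n ‖t_n(α)‖ < ∞`. -/
  summable : ∀ α, Summable fun n => ‖t n α‖
  /-- Continuous dependence of the family of amplitudes on `α`, in the norm of summability. -/
  continuous : ∀ α₀, Tendsto (fun α => ∑' n, ‖t n α - t n α₀‖) (𝓝 α₀) (𝓝 0)
  /-- `t_{-n}(α) = S_2^{-n₂} S_1^{-n₁} t_n(α)^* S_2^{n₂} S_1^{n₁}`, where `S_j = S_j^{B,α}`. -/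
  selfAdjoint : ∀ n α, t (-n) α =
    ((fluxShift B m α 1 ^ (-n.2) * fluxShift B m α 0 ^ (-n.1) : unitary LatticeOp) : LatticeOp)
      * star (t n α)
      * ((fluxShift B m α 1 ^ n.2 * fluxShift B m α 0 ^ n.1 : unitary LatticeOp) : LatticeOp)
  /-- `F t_n(α) F^* = t_n(α + 1)`. -/
  covariant : ∀ n α,
    (diracF m : LatticeOp) * t n α * star (diracF m : LatticeOp) = t n (α + 1)

/-- The Fermi level `μ` is outside the spectrum of `H_0 = H_0(1)` and outside the essential
spectrum of `H_0(lam)` for all `lam ∈ [0,1]`. -/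
def GapHypothesis (B : ℝ) (m : Site) (t : Site → ℝ → LatticeOp) (v : Site → ℝ)
    (hv : ∃ C, ∀ n, |v n| ≤ C) (μ : ℝ) : Prop :=
  μ ∉ spectrum ℝ (hamiltonian B m t v hv 0 1) ∧
  ∀ lam ∈ Set.Icc (0 : ℝ) 1, (μ : ℂ) ∉ essSpectrum (hamiltonian B m t v hv 0 lam)

/-- The Fermi projection `P_μ(lam) = χ(H_0(lam) ≤ μ)`. -/
def fermiProj (B : ℝ) (m : Site) (t : Site → ℝ → LatticeOp) (v : Site → ℝ)
    (hv : ∃ C, ∀ n, |v n| ≤ C) (μ lam : ℝ) : LatticeOp :=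
  spectralProj (hamiltonian B m t v hv 0 lam) (Set.Iic μ)

end

/-! ### Approximation of compact operators -/

section Index

variable {E F G : Type*} [NormedAddCommGroup E] [InnerProductSpace ℂ E]
  [NormedAddCommGroup F] [InnerProductSpace ℂ F] [NormedAddCommGroup G] [InnerProductSpace ℂ G]

/-! The Aharonov–Bohm gauge of one flux quantum is a pure gauge: its phase on an edge is the
quotient of the Dirac phases at the two end points (`diracPhase_eq`). Hence `F` conjugates the
operator at flux `α` to the one at `α + 1`, and `H_1 = F H_0 F*`. The gauge also decays at infinity
(`tendsto_abGauge_one`), so every `H_α - H_0` is compact and the essential spectrum does not move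
with `α`.

For projections with compact difference let `relIndex P Q` be the index of `Q : ran P → ran Q`. It
is additive along chains (`relIndex_trans`), vanishes when `‖P - Q‖ < 1`, and equals `rank (P - Q)`
when `Q ≤ P`. On one interval of a subdivision the projections `χ(H_α ≤ μ + a)` are norm continuous,
so their relative index is zero. The change of the rank of `χ_[μ,μ+a]` is therefore the relative
index of the projections `χ(H_α < μ)` at the two ends (`relIndex_spectralProj_Iio`). The sum
telescopes to `relIndex P (F P F*)` with `P = χ(H_0 < μ)`, which is `-Ind (P F P)`
(`relIndex_unitary_conj`). Replacing `<` by `≤` changes `P` by a finite rank projection and leaves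
the index alone.

For independence of `λ`, the level is raised from `μ` to a nearby `c` in a gap of `H_0(λ)`. This
does not change the index, and at level `c` the projection is norm continuous in `λ`. The index is
thus locally constant on the connected interval `[0,1]`. -/

theorem IsCompactOperator.exists_finiteRange_norm_sub_lt {K : E →L[ℂ] F} (hK : IsCompactOperator K)
    {ε : ℝ} (hε : 0 < ε) :
    ∃ R : E →L[ℂ] F, R.toLinearMap.HasFiniteRange ∧ ‖K - R‖ < ε := by
  obtain ⟨C, hC, hKC⟩ := hK.image_closedBall_subset_compact 1
  obtain ⟨s, -, hs, hcov⟩ := finite_cover_balls_of_compact hC (half_pos hε)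
  -- The approximant is `K` followed by the orthogonal projection onto the span of a finite
  -- `ε/2`-net for the image of the unit ball.
  let S : Submodule ℂ F := Submodule.span ℂ s
  have : FiniteDimensional ℂ S := FiniteDimensional.span_of_finite ℂ hs
  refine ⟨S.starProjection ∘L K, ?_, ?_⟩
  · change (S.starProjection.toLinearMap ∘ₗ K.toLinearMap).HasFiniteRange
    refine LinearMap.HasFiniteRange.comp_right ?_ _
    have h : LinearMap.range S.starProjection.toLinearMap = S := S.range_starProjection
    rw [LinearMap.HasFiniteRange, h]
    exact Submodule.fg_span hs
  · refine lt_of_le_of_lt ?_ (half_lt_self hε)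
    refine ContinuousLinearMap.opNorm_le_of_unit_norm (half_pos hε).le fun x hx => ?_
    have hx' : K x ∈ C := hKC ⟨x, by simp [hx], rfl⟩
    obtain ⟨y, hy, hxy⟩ := Set.mem_iUnion₂.1 (hcov hx')
    have hyS : y ∈ S := Submodule.subset_span hy
    have h1 : ‖K x - S.starProjection (K x)‖ ≤ ‖K x - y‖ := by
      rw [S.starProjection_minimal]
      exact ciInf_le ⟨0, by rintro _ ⟨z, rfl⟩; positivity⟩ (⟨y, hyS⟩ : S)
    exact h1.trans (by simpa [dist_eq_norm] using (Metric.mem_ball.1 hxy).le)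

theorem isCompactOperator_of_hasFiniteRange {R : E →L[ℂ] F}
    (hR : R.toLinearMap.HasFiniteRange) : IsCompactOperator R := by
  have : FiniteDimensional ℂ (LinearMap.range R.toLinearMap) := Module.Finite.iff_fg.2 hR
  have := FiniteDimensional.proper ℂ (LinearMap.range R.toLinearMap)
  have h : IsCompactOperator (LinearMap.range R.toLinearMap).subtypeL :=
    isCompactOperator_of_locallyCompactSpace_rng _
  exact h.comp_clm (R.codRestrict (LinearMap.range R.toLinearMap) fun x => ⟨x, rfl⟩)

/-! ### The index of a Fredholm operator -/

/-- The maps `1 + b ∘ a` and `1 + a ∘ b` have isomorphic kernels and cokernels. -/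
theorem LinearMap.index_id_add_comp {V W : Type*} [AddCommGroup V] [Module ℂ V] [AddCommGroup W]
    [Module ℂ W] (a : V →ₗ[ℂ] W) (b : W →ₗ[ℂ] V) :
    (LinearMap.id + b ∘ₗ a).index = (LinearMap.id + a ∘ₗ b).index := by
  have hk : Module.finrank ℂ (LinearMap.ker (LinearMap.id + b ∘ₗ a)) =
      Module.finrank ℂ (LinearMap.ker (LinearMap.id + a ∘ₗ b)) := by
    -- On the kernel `x = -b (a x)`, so `a` and `-b` are mutually inverse there; the same pair works
    -- on the cokernels.
    refine LinearEquiv.finrank_eq (LinearEquiv.ofLinearMap (LinearMap.restrict a ?_)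
      (-LinearMap.restrict b ?_) ?_ ?_)
    · intro x hx
      have := congrArg a (LinearMap.mem_ker.1 hx)
      simpa using this
    · intro x hx
      have := congrArg b (LinearMap.mem_ker.1 hx)
      simpa using this
    · ext ⟨x, hx⟩
      have hx : x + a (b x) = 0 := LinearMap.mem_ker.1 hx
      simpa [LinearMap.restrict_apply] using (eq_neg_of_add_eq_zero_left hx).symm
    · ext ⟨x, hx⟩
      have hx : x + b (a x) = 0 := LinearMap.mem_ker.1 hx
      simpa [LinearMap.restrict_apply] using (eq_neg_of_add_eq_zero_left hx).symm
  have hc : Module.finrank ℂ (V ⧸ LinearMap.range (LinearMap.id + b ∘ₗ a)) =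
      Module.finrank ℂ (W ⧸ LinearMap.range (LinearMap.id + a ∘ₗ b)) := by
    refine LinearEquiv.finrank_eq (LinearEquiv.ofLinearMap (Submodule.mapQ _ _ a ?_)
      (-Submodule.mapQ _ _ b ?_) ?_ ?_)
    · rintro _ ⟨x, rfl⟩
      exact ⟨a x, by simp⟩
    · rintro _ ⟨x, rfl⟩
      exact ⟨b x, by simp⟩
    · ext x
      simp only [LinearMap.comp_apply, Submodule.mkQ_apply, LinearMap.neg_apply,
        Submodule.mapQ_apply, LinearMap.id_apply, map_neg]
      rw [neg_eq_iff_add_eq_zero, ← Submodule.Quotient.mk_add, Submodule.Quotient.mk_eq_zero]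
      exact ⟨x, by simp [add_comm]⟩
    · ext x
      simp only [LinearMap.comp_apply, Submodule.mkQ_apply, LinearMap.neg_apply,
        Submodule.mapQ_apply, LinearMap.id_apply]
      rw [neg_eq_iff_add_eq_zero, ← Submodule.Quotient.mk_add, Submodule.Quotient.mk_eq_zero]
      exact ⟨x, by simp [add_comm]⟩
  rw [LinearMap.index_eq_finrank_sub, LinearMap.index_eq_finrank_sub, hk, hc]

/-- Factoring `r` through its range and exchanging the two factors moves the question to a
finite-dimensional space, where every endomorphism has index zero. -/
theorem LinearMap.HasFiniteRange.index_id_add {V : Type*} [AddCommGroup V] [Module ℂ V]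
    {r : V →ₗ[ℂ] V} (hr : r.HasFiniteRange) : (LinearMap.id + r).index = 0 := by
  have : FiniteDimensional ℂ (LinearMap.range r) := Module.Finite.iff_fg.2 hr
  have h : r = (LinearMap.range r).subtype ∘ₗ r.rangeRestrict := rfl
  rw [h, LinearMap.index_id_add_comp, LinearMap.index_eq_of_finiteDimensional, sub_self]

/-- `T` is a Fredholm operator of index `k`. -/
structure HasIndex (T : E →L[ℂ] F) (k : ℤ) : Prop where
  isFredholm : T.IsFredholm
  index_eq : T.toLinearMap.index = k

theorem ContinuousLinearMap.IsFredholm.hasIndex {T : E →L[ℂ] F} (hT : T.IsFredholm) :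
    HasIndex T T.toLinearMap.index := ⟨hT, rfl⟩

theorem HasIndex.unique {T : E →L[ℂ] F} {k l : ℤ} (h : HasIndex T k) (h' : HasIndex T l) :
    k = l := h.index_eq.symm.trans h'.index_eq

theorem HasIndex.comp {T : E →L[ℂ] F} {S : F →L[ℂ] G} {k l : ℤ} (hS : HasIndex S l)
    (hT : HasIndex T k) : HasIndex (S ∘L T) (l + k) := by
  constructor
  · obtain ⟨T', hT'⟩ := hT.1.exists_isQuasiInverse
    obtain ⟨S', hS'⟩ := hS.1.exists_isQuasiInverse
    exact .of_isQuasiInverse (v := T' ∘L S') (hT'.comp hS')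
  · have := hT.1.finite_ker
    have := hS.1.finite_ker
    have : FiniteDimensional ℂ (F ⧸ LinearMap.range T.toLinearMap) := hT.1.finite_coker
    have : FiniteDimensional ℂ (G ⧸ LinearMap.range S.toLinearMap) := hS.1.finite_coker
    have h := LinearMap.index_comp (f := T.toLinearMap) S.toLinearMap
    rw [hS.2, hT.2] at h
    exact h

theorem ContinuousLinearEquiv.hasIndex (e : E ≃L[ℂ] F) : HasIndex (e : E →L[ℂ] F) 0 :=
  ⟨.of_isQuasiInverse (v := (e.symm : F →L[ℂ] E)) e.toLinearEquiv.isQuasiInverse,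
    e.toLinearEquiv.index_eq_zero⟩

theorem hasIndex_zero_of_comp_eq_id {T : E →L[ℂ] F} {S : F →L[ℂ] E}
    (h1 : S ∘L T = ContinuousLinearMap.id ℂ E) (h2 : T ∘L S = ContinuousLinearMap.id ℂ F) :
    HasIndex T 0 :=
  (ContinuousLinearEquiv.equivOfInverse T S (fun x => congr($h1 x)) (fun x => congr($h2 x))).hasIndex

theorem hasIndex_of_isUnit {T : E →L[ℂ] E} (h : IsUnit T) : HasIndex T 0 := by
  obtain ⟨u, rfl⟩ := h
  exact hasIndex_zero_of_comp_eq_id u.inv_mul u.mul_inv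

theorem HasIndex.id : HasIndex (ContinuousLinearMap.id ℂ E) 0 :=
  (ContinuousLinearEquiv.refl ℂ E).hasIndex

section

open LinearMap.FiniteRangeSetoid

theorem hasIndex_id_add_of_hasFiniteRange {R : E →L[ℂ] E} (hR : R.toLinearMap.HasFiniteRange) :
    HasIndex (ContinuousLinearMap.id ℂ E + R) 0 := by
  refine ⟨.of_isQuasiInverse (v := ContinuousLinearMap.id ℂ E) ?_, hR.index_id_add⟩
  have h : (LinearMap.id + R.toLinearMap) ≈ LinearMap.id := by
    rw [equiv_iff_hasFiniteRange]
    simpa using hR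
  exact ⟨h, h⟩

/-- An operator of the form `1 + K` with `K` compact is Fredholm of index zero. -/
theorem IsCompactOperator.hasIndex_id_add [CompleteSpace E] {K : E →L[ℂ] E}
    (hK : IsCompactOperator K) : HasIndex (ContinuousLinearMap.id ℂ E + K) 0 := by
  obtain ⟨R, hR, hKR⟩ := hK.exists_finiteRange_norm_sub_lt one_pos
  obtain ⟨u, hu⟩ : IsUnit (1 + (K - R)) := by
    have := isUnit_one_sub_of_norm_lt_one (x := -(K - R)) (by rwa [norm_neg])
    rwa [sub_neg_eq_add] at this
  have hR' : ((↑u⁻¹ : E →L[ℂ] E) * R : E →L[ℂ] E).toLinearMap.HasFiniteRange :=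
    hR.comp_left _
  -- With `u = 1 + (K - R)` invertible, `1 + K = u (1 + u⁻¹ R)`.
  have h := (hasIndex_of_isUnit u.isUnit).comp (hasIndex_id_add_of_hasFiniteRange hR')
  have e : (u : E →L[ℂ] E) ∘L (ContinuousLinearMap.id ℂ E + (↑u⁻¹ : E →L[ℂ] E) * R) =
      ContinuousLinearMap.id ℂ E + K := by
    change (u : E →L[ℂ] E) * (1 + (↑u⁻¹ : E →L[ℂ] E) * R) = 1 + K
    rw [mul_add, mul_one, Units.mul_inv_cancel_left, hu]
    abel
  rwa [e] at h

/-- Atkinson's criterion: an operator that is invertible up to compact operators is Fredholm. -/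
theorem isFredholm_of_comp_eq_id_add [CompleteSpace E] [CompleteSpace F] {T : E →L[ℂ] F}
    {S : F →L[ℂ] E} {K : E →L[ℂ] E} {L : F →L[ℂ] F} (hK : IsCompactOperator K)
    (hL : IsCompactOperator L) (h1 : S ∘L T = ContinuousLinearMap.id ℂ E + K)
    (h2 : T ∘L S = ContinuousLinearMap.id ℂ F + L) : T.IsFredholm := by
  obtain ⟨A, hA, -⟩ := hK.hasIndex_id_add.1.exists_isQuasiInverse
  obtain ⟨B, -, hB⟩ := hL.hasIndex_id_add.1.exists_isQuasiInverse
  rw [← h1] at hA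
  rw [← h2] at hB
  have hl : (A ∘L S).toLinearMap ∘ₗ T.toLinearMap ≈ LinearMap.id := hA
  have hr : T.toLinearMap ∘ₗ (S ∘L B).toLinearMap ≈ LinearMap.id := hB
  refine .of_isQuasiInverse (v := A ∘L S) ⟨hl, ?_⟩
  -- The left parametrix `A S` is also a right one: modulo finite rank, `T A S = T A S (T S B) = T
  -- (A S T) S B = T S B = 1`.
  have h4 : T.toLinearMap ∘ₗ (A ∘L S).toLinearMap ≈
      (T.toLinearMap ∘ₗ (A ∘L S).toLinearMap) ∘ₗ (T.toLinearMap ∘ₗ (S ∘L B).toLinearMap) := by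
    simpa using Setoid.symm (equiv_comp_left (u' := T.toLinearMap ∘ₗ (A ∘L S).toLinearMap) hr)
  have h5 : (T.toLinearMap ∘ₗ (A ∘L S).toLinearMap) ∘ₗ (T.toLinearMap ∘ₗ (S ∘L B).toLinearMap) ≈
      T.toLinearMap ∘ₗ (S ∘L B).toLinearMap := by
    have := equiv_comp_left (u' := T.toLinearMap) (equiv_comp_right (u := (S ∘L B).toLinearMap) hl)
    simpa [LinearMap.comp_assoc] using this
  exact Setoid.trans h4 (Setoid.trans h5 hr)

/-- The Fredholm property and the index are invariant under compact perturbations. -/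
theorem HasIndex.add_compact [CompleteSpace E] [CompleteSpace F] {T K : E →L[ℂ] F} {k : ℤ}
    (hT : HasIndex T k) (hK : IsCompactOperator K) : HasIndex (T + K) k := by
  obtain ⟨S, hS1, hS2⟩ := hT.1.exists_isQuasiInverse
  have hST : IsCompactOperator (S ∘L T - ContinuousLinearMap.id ℂ E) :=
    isCompactOperator_of_hasFiniteRange (equiv_iff_hasFiniteRange.1 hS1)
  have hTS : IsCompactOperator (T ∘L S - ContinuousLinearMap.id ℂ F) :=
    isCompactOperator_of_hasFiniteRange (equiv_iff_hasFiniteRange.1 hS2)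
  -- Both `S T` and `S (T + K)` have the form `1 + compact`, so the index of `S` determines that of
  -- `T` and of `T + K` alike.
  have hS : HasIndex S (-k) := by
    have h : S.IsFredholm := .of_isQuasiInverse (v := T) ⟨hS2, hS1⟩
    have h1 := h.hasIndex.comp hT
    have h2 := hST.hasIndex_id_add
    rw [add_sub_cancel] at h2
    have h3 := h1.unique h2
    rw [← eq_neg_of_add_eq_zero_left h3]
    exact h.hasIndex
  have e1 : S ∘L (T + K) = ContinuousLinearMap.id ℂ E +
      ((S ∘L T - ContinuousLinearMap.id ℂ E) + S ∘L K) := by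
    ext; simp; abel
  have e2 : (T + K) ∘L S = ContinuousLinearMap.id ℂ F +
      ((T ∘L S - ContinuousLinearMap.id ℂ F) + K ∘L S) := by
    ext; simp; abel
  have c1 : IsCompactOperator ((S ∘L T - ContinuousLinearMap.id ℂ E) + S ∘L K) :=
    hST.add (hK.clm_comp S)
  have c2 : IsCompactOperator ((T ∘L S - ContinuousLinearMap.id ℂ F) + K ∘L S) :=
    hTS.add (hK.comp_clm S)
  have h := isFredholm_of_comp_eq_id_add c1 c2 e1 e2
  have h1 := hS.comp h.hasIndex
  rw [e1] at h1
  have h2 := h1.unique c1.hasIndex_id_add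
  rw [show k = (T + K).toLinearMap.index by linarith]
  exact h.hasIndex

end

end Index

/-! ### Operators between the ranges of projections -/

section Block

variable {E : Type*} [NormedAddCommGroup E] [InnerProductSpace ℂ E]

/-- The operator `Q A P`, regarded as an operator from `range P` to `range Q`. -/
def block (P Q A : E →L[ℂ] E) :
    LinearMap.range P.toLinearMap →L[ℂ] LinearMap.range Q.toLinearMap :=
  ((Q ∘L A ∘L P) ∘L (LinearMap.range P.toLinearMap).subtypeL).codRestrict
    (LinearMap.range Q.toLinearMap) (fun x => ⟨A (P x), rfl⟩)

theorem coe_block_apply (P Q A : E →L[ℂ] E) (x : LinearMap.range P.toLinearMap) :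
    (block P Q A x : E) = Q (A (P x)) := rfl

variable {P Q R A B : E →L[ℂ] E}

theorem IsIdempotentElem.apply_apply (hP : IsIdempotentElem P) (x : E) : P (P x) = P x :=
  congr($hP x)

theorem IsIdempotentElem.apply_of_mem_range (hP : IsIdempotentElem P)
    (x : LinearMap.range P.toLinearMap) : P x = x := by
  obtain ⟨_, y, rfl⟩ := x
  exact hP.apply_apply y

theorem IsIdempotentElem.isClosed_range (hP : IsIdempotentElem P) :
    IsClosed (LinearMap.range P.toLinearMap : Set E) := by
  have h : (LinearMap.range P.toLinearMap : Set E) = {x | P x = x} := by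
    ext x
    exact ⟨fun hx => hP.apply_of_mem_range ⟨x, hx⟩, fun hx => ⟨x, hx⟩⟩
  rw [h]
  exact isClosed_eq P.continuous continuous_id

theorem IsIdempotentElem.completeSpace_range [CompleteSpace E] (hP : IsIdempotentElem P) :
    CompleteSpace (LinearMap.range P.toLinearMap) :=
  hP.isClosed_range.completeSpace_coe

theorem block_congr (h : Q * A * P = Q * B * P) : block P Q A = block P Q B := by
  ext x
  exact congr($h x)

theorem block_add (P Q A B : E →L[ℂ] E) : block P Q (A + B) = block P Q A + block P Q B := by
  ext x
  simp [coe_block_apply]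

theorem block_comp (hQ : IsIdempotentElem Q) (P R A B : E →L[ℂ] E) :
    block Q R B ∘L block P Q A = block P R (B * Q * A) := by
  ext x
  simp [coe_block_apply, hQ.apply_apply]

theorem block_self_of_mul_mul_eq (hP : IsIdempotentElem P) (h : P * A * P = P) :
    block P P A = ContinuousLinearMap.id ℂ _ := by
  ext x
  have h1 : P (A (P x)) = P x := congr($h x)
  rw [coe_block_apply, h1, hP.apply_of_mem_range]
  rfl

theorem IsCompactOperator.block (hA : IsCompactOperator A) (hQ : IsIdempotentElem Q) :
    IsCompactOperator (block P Q A) :=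
  ((hA.clm_comp Q).comp_clm (P ∘L (LinearMap.range P.toLinearMap).subtypeL)).codRestrict
    (V := LinearMap.range Q.toLinearMap) (fun x => ⟨A (P x), rfl⟩) hQ.isClosed_range

/-- Only the corner `Q * A * P` enters the operator, so compactness is asked of corners alone. This
is how a product of blocks gets replaced by a simpler block below. -/
theorem HasIndex.block_of_sub [CompleteSpace E] {k : ℤ} (h : HasIndex (_root_.block P Q A) k)
    (hP : IsIdempotentElem P) (hQ : IsIdempotentElem Q)
    (hc : IsCompactOperator (Q * B * P - Q * A * P)) : HasIndex (_root_.block P Q B) k := by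
  have := hP.completeSpace_range
  have := hQ.completeSpace_range
  have h1 := h.add_compact (hc.block (P := P) hQ)
  rw [← block_add] at h1
  rwa [block_congr (B := B)] at h1
  have hQ' : ∀ X, Q * (Q * X) = Q * X := fun X => by rw [← mul_assoc, hQ.eq]
  simp only [mul_add, add_mul, mul_sub, sub_mul, mul_assoc, hP.eq, hQ']
  abel

theorem IsCompactOperator.mul_left {K : E →L[ℂ] E} (hK : IsCompactOperator K) (A : E →L[ℂ] E) :
    IsCompactOperator (A * K) := hK.clm_comp A

theorem IsCompactOperator.mul_right {K : E →L[ℂ] E} (hK : IsCompactOperator K) (A : E →L[ℂ] E) :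
    IsCompactOperator (K * A) := hK.comp_clm A

theorem IsCompactOperator.sub_rev {K L : E →L[ℂ] E} (h : IsCompactOperator (K - L)) :
    IsCompactOperator (L - K) := by
  simpa using h.neg

/-- If `A` and `B` are inverse to each other up to compact operators, when regarded as operators
between the ranges of `P` and `Q`, then `A` is Fredholm. -/
theorem isFredholm_block [CompleteSpace E] (hP : IsIdempotentElem P) (hQ : IsIdempotentElem Q)
    (h1 : IsCompactOperator (P * B * Q * A * P - P))
    (h2 : IsCompactOperator (Q * A * P * B * Q - Q)) : (block P Q A).IsFredholm := by
  have := hP.completeSpace_range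
  have := hQ.completeSpace_range
  refine isFredholm_of_comp_eq_id_add (S := block Q P B) (K := block P P (P * B * Q * A * P - P))
    (L := block Q Q (Q * A * P * B * Q - Q)) (h1.block hP) (h2.block hQ) ?_ ?_
  · rw [block_comp hQ, ← block_self_of_mul_mul_eq hP (A := P) (by rw [hP.eq, hP.eq]), ← block_add]
    refine block_congr ?_
    rw [add_sub_cancel]
    simp only [mul_assoc, hP.eq]
    simp only [← mul_assoc, hP.eq]
  · rw [block_comp hP, ← block_self_of_mul_mul_eq hQ (A := Q) (by rw [hQ.eq, hQ.eq]), ← block_add]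
    refine block_congr ?_
    rw [add_sub_cancel]
    simp only [mul_assoc, hQ.eq]
    simp only [← mul_assoc, hQ.eq]

/-! ### The relative index of a pair of projections -/

/-- The relative index of two projections with compact difference: the index of `Q` as an operator
from `range P` to `range Q`. -/
noncomputable def relIndex (P Q : E →L[ℂ] E) : ℤ := (block P Q 1).toLinearMap.index

theorem hasIndex_relIndex [CompleteSpace E] (hP : IsIdempotentElem P) (hQ : IsIdempotentElem Q)
    (h : IsCompactOperator (P - Q)) : HasIndex (block P Q 1) (relIndex P Q) := by
  refine (isFredholm_block (B := 1) hP hQ ?_ ?_).hasIndex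
  · convert! (h.sub_rev.mul_left P).mul_right P using 2
    simp only [mul_one, mul_sub, sub_mul, hP.eq]
  · convert! (h.mul_left Q).mul_right Q using 2
    simp only [mul_one, mul_sub, sub_mul, hQ.eq]

/-- The composition `ran P → ran Q → ran R` is the corner `R Q P`, and `R P - R Q P = R (P - Q) P`
is compact. -/
theorem relIndex_trans [CompleteSpace E] (hP : IsIdempotentElem P) (hQ : IsIdempotentElem Q)
    (hR : IsIdempotentElem R) (hPQ : IsCompactOperator (P - Q)) (hQR : IsCompactOperator (Q - R)) :
    relIndex P R = relIndex P Q + relIndex Q R := by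
  have hPR : IsCompactOperator (P - R) := by simpa using hPQ.add hQR
  have h := (hasIndex_relIndex hQ hR hQR).comp (hasIndex_relIndex hP hQ hPQ)
  rw [block_comp hQ] at h
  rw [add_comm]
  refine (hasIndex_relIndex hP hR hPR).unique (h.block_of_sub hP hR ?_)
  convert! (hPQ.mul_left R).mul_right P using 2
  simp only [mul_one, one_mul, mul_sub, sub_mul, hP.eq, mul_assoc]

theorem relIndex_self (hP : IsIdempotentElem P) : relIndex P P = 0 := by
  rw [relIndex, block_self_of_mul_mul_eq hP (by rw [mul_one, hP.eq])]
  exact HasIndex.id.index_eq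

theorem relIndex_symm [CompleteSpace E] (hP : IsIdempotentElem P) (hQ : IsIdempotentElem Q)
    (h : IsCompactOperator (P - Q)) : relIndex P Q = -relIndex Q P := by
  have h1 := relIndex_trans hP hQ hP h h.sub_rev
  rw [relIndex_self hP] at h1
  linarith

/-- If `Q P = P Q = P`, the relative index of `Q` and `P` is the rank of `Q - P`. -/
theorem relIndex_of_le (hP : IsIdempotentElem P) (hQ : IsIdempotentElem Q) (hQP : Q * P = P)
    (hPQ : P * Q = P) :
    relIndex Q P = Module.finrank ℂ (LinearMap.range (Q - P).toLinearMap) := by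
  -- The map `P : ran Q → ran P` is onto, so its index is the dimension of its kernel, and that
  -- kernel is `ran (Q - P)`.
  have hs : Function.Surjective (block Q P 1).toLinearMap := by
    intro y
    have hy : Q y = y := by
      rw [← hP.apply_of_mem_range y]
      exact congr($hQP y)
    refine ⟨⟨y, y, hy⟩, ?_⟩
    ext
    change P (Q y) = y
    rw [hy, hP.apply_of_mem_range]
  rw [relIndex, LinearMap.index_of_surjective hs,
    ← Submodule.finrank_map_subtype_eq (LinearMap.range Q.toLinearMap)]
  have hPQ' : ∀ x, P (Q x) = P x := fun x => congr($hPQ x)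
  have hQP' : ∀ x, Q (P x) = P x := fun x => congr($hQP x)
  suffices e : (LinearMap.ker (block Q P 1).toLinearMap).map
      (LinearMap.range Q.toLinearMap).subtype = LinearMap.range (Q - P).toLinearMap by rw [e]
  ext x
  constructor
  · rintro ⟨z, hz, rfl⟩
    have hz : P (Q z) = 0 := congrArg Subtype.val (LinearMap.mem_ker.1 hz)
    refine ⟨z, ?_⟩
    change Q z - P z = z
    rw [hQ.apply_of_mem_range] at hz ⊢
    rw [hz, sub_zero]
  · rintro ⟨z, rfl⟩
    refine ⟨⟨Q z - P z, Q z - P z, ?_⟩, ?_, rfl⟩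
    · change Q (Q z - P z) = _
      rw [map_sub, hQ.apply_apply, hQP']
    · refine LinearMap.mem_ker.2 (Subtype.ext ?_)
      change P (Q (Q z - P z)) = 0
      rw [hPQ', map_sub, hP.apply_apply, hPQ', sub_self]

/-- If `‖P - Q‖ < 1`, then `P Q P` is invertible on `range P`. -/
theorem isUnit_block_self [CompleteSpace E] (hP : IsIdempotentElem P) (hP1 : ‖P‖ ≤ 1)
    (h : ‖P - Q‖ < 1) : IsUnit (block P P Q) := by
  have := hP.completeSpace_range
  have e : block P P Q = 1 - block P P (P - Q) := by
    rw [eq_sub_iff_add_eq, ← block_add, add_sub_cancel,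
      block_self_of_mul_mul_eq hP (by rw [hP.eq, hP.eq])]
    rfl
  suffices hn : ‖block P P (P - Q)‖ < 1 by
    rw [e]
    exact isUnit_one_sub_of_norm_lt_one (x := block P P (P - Q)) hn
  refine lt_of_le_of_lt ?_ h
  refine ContinuousLinearMap.opNorm_le_bound _ (norm_nonneg _) fun x => ?_
  change ‖P ((P - Q) (P x))‖ ≤ _
  rw [hP.apply_of_mem_range]
  calc ‖P ((P - Q) x)‖ ≤ ‖P‖ * ‖(P - Q) x‖ := P.le_opNorm _
    _ ≤ 1 * (‖P - Q‖ * ‖(x : E)‖) := by gcongr; exact (P - Q).le_opNorm _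
    _ = ‖P - Q‖ * ‖x‖ := by rw [one_mul, Submodule.coe_norm]

/-- The two compositions of `ran P → ran Q` with `ran Q → ran P` are `P Q P` and `Q P Q`, both
invertible. No compactness of `P - Q` is needed. -/
theorem hasIndex_block_one_of_norm_sub_lt [CompleteSpace E] (hP : IsIdempotentElem P)
    (hQ : IsIdempotentElem Q) (hP1 : ‖P‖ ≤ 1) (hQ1 : ‖Q‖ ≤ 1) (h : ‖P - Q‖ < 1) :
    HasIndex (block P Q 1) 0 := by
  have h1 := isUnit_block_self hP hP1 h
  have h2 := isUnit_block_self hQ hQ1 (by rwa [norm_sub_rev] at h)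
  have e1 : block Q P 1 ∘L block P Q 1 = block P P Q := by
    rw [block_comp hQ, one_mul, mul_one]
  have e2 : block P Q 1 ∘L block Q P 1 = block Q Q P := by
    rw [block_comp hP, one_mul, mul_one]
  have := hP.completeSpace_range
  have := hQ.completeSpace_range
  have hb : Function.Bijective (block P Q 1) := by
    constructor
    · refine Function.Injective.of_comp (f := block Q P 1) ?_
      rw [← ContinuousLinearMap.coe_comp, e1]
      exact ((ContinuousLinearMap.isUnit_iff_bijective).1 h1).1
    · refine Function.Surjective.of_comp (g := block Q P 1) ?_
      rw [← ContinuousLinearMap.coe_comp, e2]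
      exact ((ContinuousLinearMap.isUnit_iff_bijective).1 h2).2
  let e := ContinuousLinearEquiv.ofBijective (block P Q 1) (LinearMap.ker_eq_bot.2 hb.1)
    (LinearMap.range_eq_top.2 hb.2)
  exact e.hasIndex

theorem relIndex_eq_zero_of_norm_sub_lt [CompleteSpace E] (hP : IsIdempotentElem P)
    (hQ : IsIdempotentElem Q) (hP1 : ‖P‖ ≤ 1) (hQ1 : ‖Q‖ ≤ 1) (h : ‖P - Q‖ < 1) :
    relIndex P Q = 0 :=
  (hasIndex_block_one_of_norm_sub_lt hP hQ hP1 hQ1 h).index_eq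

/-! ### The index of a compressed unitary -/

/-- The parametrix is `P V P`: the error `P V P U P - P` equals `P [V, P] U P`, and `[V, P] = -V [U,
P] V` is compact too. -/
theorem isFredholm_block_of_commutator [CompleteSpace E] (hP : IsIdempotentElem P)
    {U V : E →L[ℂ] E} (hUV : U * V = 1) (hVU : V * U = 1)
    (h : IsCompactOperator (U * P - P * U)) : (block P P U).IsFredholm := by
  have h' : IsCompactOperator (V * P - P * V) := by
    convert! ((h.mul_left V).mul_right V).neg using 1
    have e : V * (U * P - P * U) * V = P * V - V * P := by
      rw [mul_sub, sub_mul, ← mul_assoc, hVU, one_mul, mul_assoc V, mul_assoc P, hUV, mul_one]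
    rw [e, ← FunLike.coe_neg, neg_sub]
  refine isFredholm_block (B := V) hP hP ?_ ?_
  · convert! ((h'.mul_left P).mul_right (U * P)) using 2
    rw [mul_sub, sub_mul, ← mul_assoc P P, hP.eq]
    simp only [mul_assoc]
    rw [← mul_assoc V U, hVU, one_mul, hP.eq]
  · convert! ((h.mul_left P).mul_right (V * P)) using 2
    rw [mul_sub, sub_mul, ← mul_assoc P P, hP.eq]
    simp only [mul_assoc]
    rw [← mul_assoc U V, hUV, one_mul, hP.eq]

/-- The index of `P U P` on `range P` does not change under compact perturbations of `P`. -/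
theorem index_block_eq_of_isCompactOperator_sub [CompleteSpace E] (hP : IsIdempotentElem P)
    (hQ : IsIdempotentElem Q) {U V : E →L[ℂ] E} (hUV : U * V = 1) (hVU : V * U = 1)
    (h : IsCompactOperator (U * P - P * U)) (hPQ : IsCompactOperator (P - Q)) :
    (block Q Q U).toLinearMap.index = (block P P U).toLinearMap.index := by
  have hF := (isFredholm_block_of_commutator hP hUV hVU h).hasIndex
  -- Along `ran Q → ran P → ran P → ran Q` the two relative indices cancel, and the composition is
  -- `Q U Q` up to a compact operator.
  have h1 := ((hasIndex_relIndex hP hQ hPQ).comp hF).comp (hasIndex_relIndex hQ hP hPQ.sub_rev)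
  rw [block_comp hP, block_comp hP] at h1
  have h2 := h1.block_of_sub (B := U) hQ hQ ?_
  · rw [h2.index_eq, relIndex_symm hP hQ hPQ]
    ring
  · have e : Q * U * Q - Q * (1 * P * U * P * 1) * Q =
        Q * (Q - P) * (U * Q) + Q * P * U * ((Q - P) * Q) := by
      simp only [mul_sub, sub_mul, mul_one, one_mul, ← mul_assoc, hQ.eq]
      abel
    rw [e]
    exact ((hPQ.sub_rev.mul_left Q).mul_right _).add ((hPQ.sub_rev.mul_right Q).mul_left _)

/-- The index of `P U P` on `range P` is locally constant in `P`. -/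
theorem index_block_eq_of_norm_sub_lt [CompleteSpace E] (hP : IsIdempotentElem P)
    (hQ : IsIdempotentElem Q) (hP1 : ‖P‖ ≤ 1) (hQ1 : ‖Q‖ ≤ 1) (hd : ‖P - Q‖ < 1)
    {U V : E →L[ℂ] E} (hUV : U * V = 1) (hVU : V * U = 1)
    (h : IsCompactOperator (U * P - P * U)) (h' : IsCompactOperator (U * Q - Q * U)) :
    (block Q Q U).toLinearMap.index = (block P P U).toLinearMap.index := by
  have hd' : ‖Q - P‖ < 1 := by rwa [norm_sub_rev] at hd
  have hF := (isFredholm_block_of_commutator hP hUV hVU h).hasIndex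
  have hF' := (isFredholm_block_of_commutator hQ hUV hVU h').hasIndex
  -- The corner `Q P U P Q` has the index of `P U P`, and `Q P Q U Q` has the index of `Q U Q` since
  -- `Q P Q` is invertible. The two differ by terms containing a commutator with `U`, although `P -
  -- Q` itself need not be compact.
  have h1 := ((hasIndex_block_one_of_norm_sub_lt hP hQ hP1 hQ1 hd).comp hF).comp
    (hasIndex_block_one_of_norm_sub_lt hQ hP hQ1 hP1 hd')
  have h2 := (hasIndex_of_isUnit (isUnit_block_self hQ hQ1 hd')).comp hF'
  rw [block_comp hP, block_comp hP] at h1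
  rw [block_comp hQ] at h2
  have h3 := (h2.block_of_sub (B := 1 * P * U * P * 1) hQ hQ ?_).unique h1
  · linarith
  · have e : Q * (1 * P * U * P * 1) * Q - Q * (P * Q * U) * Q =
        (Q * P) * (U * P - P * U) * Q + (Q * P) * (U * Q - Q * U) * Q := by
      simp only [mul_sub, sub_mul, mul_one, one_mul, ← mul_assoc]
      rw [mul_assoc Q P P, hP.eq, mul_assoc (Q * P * U) Q Q, hQ.eq]
      abel
    rw [e]
    exact ((h.mul_left (Q * P)).mul_right Q).add ((h'.mul_left (Q * P)).mul_right Q)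

end Block

/-! ### Spectral theory near a point outside the essential spectrum -/

section Spectral

variable {E : Type*} [NormedAddCommGroup E] [InnerProductSpace ℂ E]

theorem not_mem_essSpectrum_iff {T : E →L[ℂ] E} {z : ℂ} :
    z ∉ essSpectrum T ↔ (T - z • (1 : E →L[ℂ] E)).IsFredholm := not_not

variable [CompleteSpace E]

theorem essSpectrum_subset_of_isCompactOperator_sub {T T' : E →L[ℂ] E}
    (h : IsCompactOperator (T - T')) : essSpectrum T ⊆ essSpectrum T' := by
  intro z hz
  by_contra hz'
  refine hz ?_
  have h1 := (not_mem_essSpectrum_iff.1 hz').hasIndex.add_compact h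
  convert! h1.isFredholm using 1
  abel

/-- A self-adjoint Fredholm operator becomes invertible by adding the projection on its kernel. -/
theorem exists_isUnit_add_of_isFredholm {A : E →L[ℂ] E} (hA : IsSelfAdjoint A)
    (hF : A.IsFredholm) :
    ∃ p : E →L[ℂ] E, p * p = p ∧ A * p = 0 ∧ p * A = 0 ∧ p.toLinearMap.HasFiniteRange ∧
      IsUnit (A + p) := by
  let N := LinearMap.ker A.toLinearMap
  have : FiniteDimensional ℂ N := hF.finite_ker
  have hp : IsStarProjection N.starProjection := isStarProjection_starProjection
  have hAp : A * N.starProjection = 0 := by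
    ext x
    exact LinearMap.mem_ker.1 (N.starProjection_apply_mem x)
  have hpA : N.starProjection * A = 0 := by
    have := congrArg star hAp
    rwa [star_mul, hA.star_eq, hp.isSelfAdjoint.star_eq, star_zero] at this
  have hAp' : ∀ x, A (N.starProjection x) = 0 := fun x => congr($hAp x)
  have hpA' : ∀ x, N.starProjection (A x) = 0 := fun x => congr($hpA x)
  have hpp : ∀ x, N.starProjection (N.starProjection x) = N.starProjection x :=
    fun x => congr($(hp.isIdempotentElem) x)
  refine ⟨N.starProjection, hp.isIdempotentElem, hAp, hpA, ?_, ?_⟩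
  · have h : LinearMap.range N.starProjection.toLinearMap = N := N.range_starProjection
    rw [LinearMap.HasFiniteRange, h]
    exact Module.Finite.iff_fg.1 inferInstance
  · rw [ContinuousLinearMap.isUnit_iff_bijective]
    constructor
    · rw [injective_iff_map_eq_zero]
      intro x hx
      have hx : A x + N.starProjection x = 0 := hx
      have h1 : N.starProjection x = 0 := by
        have := congrArg N.starProjection hx
        rwa [map_add, hpA', hpp, zero_add, map_zero] at this
      rw [h1, add_zero] at hx
      rw [← h1, eq_comm, Submodule.starProjection_eq_self_iff]
      exact LinearMap.mem_ker.2 hx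
    · intro w
      have hw : w - N.starProjection w ∈ Nᗮ := N.sub_starProjection_mem_orthogonal w
      -- A Fredholm operator has closed range, so self-adjointness gives `(ker A)ᗮ = ran A` without
      -- a closure.
      have hr : Nᗮ = LinearMap.range A.toLinearMap := by
        have h := A.orthogonal_ker
        rw [← ContinuousLinearMap.star_eq_adjoint, hA.star_eq] at h
        exact h.trans hF.isClosed_range.submodule_topologicalClosure_eq
      rw [hr] at hw
      obtain ⟨u, hu⟩ := hw
      have hu : A u = w - N.starProjection w := hu
      refine ⟨u - N.starProjection u + N.starProjection w, ?_⟩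
      simp [hAp', hpp, hu]

/-- Everything commutes with `p`. On `ran p` the operator `A - z` is `-z`, and on `ran (1 - p)` it
agrees with `u = A + p - z`, which stays invertible for small `z`. Hence the inverse `u⁻¹ (1 - p) -
z⁻¹ p`. -/
theorem eventually_isUnit_sub_smul {A p : E →L[ℂ] E} (hp : p * p = p) (hAp : A * p = 0)
    (hpA : p * A = 0) (hu : IsUnit (A + p)) : ∀ᶠ z in 𝓝[≠] (0 : ℂ), IsUnit (A - z • 1) := by
  have h1 : ∀ᶠ z in 𝓝 (0 : ℂ), IsUnit (A + p - z • (1 : E →L[ℂ] E)) := by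
    have hc : ContinuousAt (fun z : ℂ => A + p - z • (1 : E →L[ℂ] E)) 0 := by fun_prop
    refine hc.eventually (Units.isOpen.mem_nhds ?_)
    simpa using hu
  filter_upwards [nhdsWithin_le_nhds h1, self_mem_nhdsWithin] with z ⟨u, hu⟩ hz
  have e1 : (u : E →L[ℂ] E) * p = (1 - z) • p := by
    rw [hu, sub_mul, add_mul, hAp, hp, zero_add, smul_mul_assoc, one_mul, sub_smul, one_smul]
  have e2 : p * (u : E →L[ℂ] E) = (1 - z) • p := by
    rw [hu, mul_sub, mul_add, hpA, hp, zero_add, mul_smul_comm, mul_one, sub_smul, one_smul]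
  have hcomm : Commute p (u : E →L[ℂ] E) := e2.trans e1.symm
  have hcomm' : p * (↑u⁻¹ : E →L[ℂ] E) = (↑u⁻¹ : E →L[ℂ] E) * p := hcomm.units_inv_right
  have e3 : A - z • 1 = (u : E →L[ℂ] E) - p := by rw [hu]; abel
  have hz : z ≠ 0 := hz
  have e4 : z⁻¹ • ((1 - z) • p - p) = -p := by
    rw [sub_smul, one_smul, sub_sub_cancel_left, smul_neg, smul_smul, inv_mul_cancel₀ hz, one_smul]
  have hp1 : p * (1 - p) = 0 := by rw [mul_sub, mul_one, hp, sub_self]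
  refine ⟨⟨A - z • 1, (↑u⁻¹ : E →L[ℂ] E) * (1 - p) - z⁻¹ • p, ?_, ?_⟩, rfl⟩
  · have e5 : ((u : E →L[ℂ] E) - p) * ((↑u⁻¹ : E →L[ℂ] E) * (1 - p)) = 1 - p := by
      rw [sub_mul, Units.mul_inv_cancel_left, ← mul_assoc, hcomm', mul_assoc, hp1, mul_zero,
        sub_zero]
    rw [e3, mul_sub, e5, mul_smul_comm, sub_mul, e1, hp, e4]
    abel
  · have e5 : (1 - p) * ((u : E →L[ℂ] E) - p) = u * (1 - p) := by
      rw [sub_mul, one_mul, mul_sub, e2, hp, mul_sub, e1, mul_one]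
      abel
    rw [e3, sub_mul, mul_assoc, e5, Units.inv_mul_cancel_left, smul_mul_assoc, mul_sub, e2, hp, e4]
    abel

theorem IsSelfAdjoint.sub_ofReal_smul_one {H : E →L[ℂ] E} (hH : IsSelfAdjoint H) (x : ℝ) :
    IsSelfAdjoint (H - (x : ℂ) • (1 : E →L[ℂ] E)) :=
  hH.sub (IsSelfAdjoint.smul (Complex.conj_ofReal x) (IsSelfAdjoint.one _))

omit [CompleteSpace E] in
theorem not_mem_spectrum_real_iff {H : E →L[ℂ] E} {x : ℝ} :
    x ∉ spectrum ℝ H ↔ IsUnit (H - (x : ℂ) • (1 : E →L[ℂ] E)) := by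
  rw [spectrum.notMem_iff, ← IsUnit.neg_iff, neg_sub]
  rfl

/-- This isolation makes the indicator of a half-line ending at `x` continuous on the spectrum, so
that the continuous functional calculus produces the spectral projections. -/
theorem eventually_not_mem_spectrum {H : E →L[ℂ] E} (hH : IsSelfAdjoint H) {x : ℝ}
    (hx : (x : ℂ) ∉ essSpectrum H) : ∀ᶠ y in 𝓝[≠] x, y ∉ spectrum ℝ H := by
  obtain ⟨p, hp, h1, h2, -, hu⟩ := exists_isUnit_add_of_isFredholm (hH.sub_ofReal_smul_one x)
    (not_mem_essSpectrum_iff.1 hx)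
  have h := eventually_isUnit_sub_smul hp h1 h2 hu
  have ht : Tendsto (fun y : ℝ => ((y - x : ℝ) : ℂ)) (𝓝[≠] x) (𝓝[≠] 0) := by
    refine tendsto_nhdsWithin_iff.2 ⟨?_, ?_⟩
    · refine Tendsto.mono_left ?_ nhdsWithin_le_nhds
      have : ContinuousAt (fun y : ℝ => ((y - x : ℝ) : ℂ)) x := by fun_prop
      simpa [ContinuousAt] using this
    · filter_upwards [self_mem_nhdsWithin] with y hy
      simpa [sub_eq_zero] using hy
  filter_upwards [ht.eventually h] with y hy
  rw [not_mem_spectrum_real_iff]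
  convert! hy using 1
  push_cast
  rw [sub_smul]
  abel

/-- Near a self-adjoint operator, the complement of the essential spectrum is open. -/
theorem eventually_not_mem_essSpectrum {H : E →L[ℂ] E} (hH : IsSelfAdjoint H) {x : ℝ}
    (hx : (x : ℂ) ∉ essSpectrum H) :
    ∀ᶠ q : (E →L[ℂ] E) × ℝ in 𝓝 (H, x), (q.2 : ℂ) ∉ essSpectrum q.1 := by
  obtain ⟨p, -, -, -, hp, hu⟩ := exists_isUnit_add_of_isFredholm (hH.sub_ofReal_smul_one x)
    (not_mem_essSpectrum_iff.1 hx)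
  have hc : Continuous fun q : (E →L[ℂ] E) × ℝ => q.1 - (q.2 : ℂ) • (1 : E →L[ℂ] E) + p := by
    fun_prop
  filter_upwards [hc.continuousAt.eventually (Units.isOpen.mem_nhds hu)] with q hq
  rw [not_mem_essSpectrum_iff]
  have h := (hasIndex_of_isUnit hq).add_compact (K := -p)
    (isCompactOperator_of_hasFiniteRange hp).neg
  convert! h.isFredholm using 1
  abel

end Spectral

/-! ### Spectral projections -/

section SpectralProj

variable {E : Type*} [NormedAddCommGroup E] [InnerProductSpace ℂ E] [CompleteSpace E]

/-- The frontier points of `s` are isolated points of the spectrum of `H`, or outside of it. -/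
def HasDiscreteFrontier (H : E →L[ℂ] E) (s : Set ℝ) : Prop :=
  ∀ c ∈ frontier s, ∀ᶠ y in 𝓝[≠] c, y ∉ spectrum ℝ H

theorem eventually_not_mem_spectrum_of_not_mem {H : E →L[ℂ] E} {x : ℝ} (hx : x ∉ spectrum ℝ H) :
    ∀ᶠ y in 𝓝[≠] x, y ∉ spectrum ℝ H :=
  nhdsWithin_le_nhds ((spectrum.isClosed H).isOpen_compl.mem_nhds hx)

variable {H H' : E →L[ℂ] E} {s t : Set ℝ}

omit [CompleteSpace E] in
theorem HasDiscreteFrontier.continuousOn_indicator (h : HasDiscreteFrontier H s) :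
    ContinuousOn (s.indicator fun _ => (1 : ℝ)) (spectrum ℝ H) := by
  intro c hc
  -- At an isolated point of the spectrum every function is continuous; off the frontier the
  -- indicator is locally constant.
  by_cases hcs : c ∈ frontier s
  · have h1 : 𝓝[spectrum ℝ H] c ≤ pure c := by
      rw [le_pure_iff]
      have h2 := h c hcs
      rw [eventually_nhdsWithin_iff] at h2
      rw [mem_nhdsWithin_iff_eventually]
      filter_upwards [h2] with y hy hys
      by_contra hyc
      exact hy hyc hys
    exact Tendsto.mono_left (tendsto_pure_nhds _ _) h1
  · exact (continuousOn_const.continuousAt_indicator hcs).continuousWithinAt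

theorem isStarProjection_spectralProj (h : HasDiscreteFrontier H s) :
    IsStarProjection (spectralProj H s) := by
  refine ⟨?_, cfc_predicate _ H⟩
  rw [IsIdempotentElem, spectralProj, ← cfc_mul _ _ H h.continuousOn_indicator
    h.continuousOn_indicator]
  refine cfc_congr fun x _ => ?_
  by_cases hx : x ∈ s <;> simp [hx]

theorem spectralProj_mul (hs : HasDiscreteFrontier H s) (ht : HasDiscreteFrontier H t) :
    spectralProj H s * spectralProj H t = spectralProj H (s ∩ t) := by
  rw [spectralProj, spectralProj, spectralProj, ← cfc_mul _ _ H hs.continuousOn_indicator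
    ht.continuousOn_indicator]
  refine cfc_congr fun x _ => ?_
  by_cases hx : x ∈ s <;> by_cases hx' : x ∈ t <;> simp [hx, hx']

theorem spectralProj_sub (hs : HasDiscreteFrontier H s) (ht : HasDiscreteFrontier H t)
    (hts : t ⊆ s) : spectralProj H s - spectralProj H t = spectralProj H (s \ t) := by
  rw [spectralProj, spectralProj, spectralProj, ← cfc_sub _ _ H hs.continuousOn_indicator
    ht.continuousOn_indicator]
  refine cfc_congr fun x _ => ?_
  by_cases hx : x ∈ s <;> by_cases hx' : x ∈ t
  · simp [hx, hx']
  · simp [hx, hx']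
  · exact absurd (hts hx') hx
  · simp [hx, hx']

omit [CompleteSpace E] in
theorem hasDiscreteFrontier_Iic {c : ℝ} (h : ∀ᶠ y in 𝓝[≠] c, y ∉ spectrum ℝ H) :
    HasDiscreteFrontier H (Set.Iic c) := by
  intro x hx
  rw [frontier_Iic, Set.mem_singleton_iff] at hx
  rwa [hx]

omit [CompleteSpace E] in
theorem hasDiscreteFrontier_Iio {c : ℝ} (h : ∀ᶠ y in 𝓝[≠] c, y ∉ spectrum ℝ H) :
    HasDiscreteFrontier H (Set.Iio c) := by
  intro x hx
  rw [frontier_Iio, Set.mem_singleton_iff] at hx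
  rwa [hx]

/-- The range lies in the kernel of the Fredholm operator `H - x`. -/
theorem hasFiniteRange_spectralProj_singleton (hH : IsSelfAdjoint H) {x : ℝ}
    (hx : (x : ℂ) ∉ essSpectrum H) : (spectralProj H {x}).toLinearMap.HasFiniteRange := by
  have hd : HasDiscreteFrontier H {x} := by
    intro y hy
    rw [(frontier_subset_closure.trans_eq isClosed_singleton.closure_eq) hy]
    exact eventually_not_mem_spectrum hH hx
  have h1 : (H - (x : ℂ) • (1 : E →L[ℂ] E)) * spectralProj H {x} = 0 := by
    have e : H - (x : ℂ) • (1 : E →L[ℂ] E) = cfc (fun y : ℝ => y - x) H := by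
      rw [cfc_sub .., cfc_id' ℝ H, cfc_const x H]
      rfl
    rw [e, spectralProj, ← cfc_mul _ _ H (by fun_prop) hd.continuousOn_indicator,
      ← cfc_const_zero ℝ H]
    refine cfc_congr fun y _ => ?_
    by_cases hy : y = x <;> simp [hy]
  have h2 : LinearMap.range (spectralProj H {x}).toLinearMap ≤
      LinearMap.ker (H - (x : ℂ) • (1 : E →L[ℂ] E)).toLinearMap := by
    rintro _ ⟨y, rfl⟩
    exact LinearMap.mem_ker.2 congr($h1 y)
  have := (not_mem_essSpectrum_iff.1 hx).finite_ker
  exact Module.Finite.iff_fg.1 (Submodule.finiteDimensional_of_le h2)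

theorem finite_spectrum_inter_Icc (hH : IsSelfAdjoint H) {a b : ℝ}
    (h : ∀ x ∈ Set.Icc a b, (x : ℂ) ∉ essSpectrum H) : (spectrum ℝ H ∩ Set.Icc a b).Finite := by
  have hp : (spectrum ℝ H ∩ Set.Icc a b ∩ Set.Icc a b).Finite := by
    refine isCompact_Icc.induction_on (p := fun t => (spectrum ℝ H ∩ Set.Icc a b ∩ t).Finite)
      (by simp) (fun s t hst ht => ht.subset (by gcongr))
      (fun s t hs ht => by rw [Set.inter_union_distrib_left]; exact hs.union ht) fun x hx => ?_
    have h1 := eventually_not_mem_spectrum hH (h x hx)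
    rw [eventually_nhdsWithin_iff] at h1
    refine ⟨_, nhdsWithin_le_nhds h1, (Set.finite_singleton x).subset ?_⟩
    rintro y ⟨⟨hy, -⟩, hy'⟩
    by_contra hyx
    exact hy' hyx hy
  rwa [Set.inter_assoc, Set.inter_self] at hp

/-- Spectral projections on bounded intervals outside the essential spectrum have finite rank. -/
theorem hasFiniteRange_spectralProj_Icc (hH : IsSelfAdjoint H) {a b : ℝ}
    (h : ∀ x ∈ Set.Icc a b, (x : ℂ) ∉ essSpectrum H) :
    (spectralProj H (Set.Icc a b)).toLinearMap.HasFiniteRange := by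
  classical
  have hfin := finite_spectrum_inter_Icc hH h
  have hmem : ∀ x ∈ hfin.toFinset, (x : ℂ) ∉ essSpectrum H := fun x hx =>
    h x ((hfin.mem_toFinset.1 hx).2)
  have hcont : ∀ x ∈ hfin.toFinset,
      ContinuousOn (({x} : Set ℝ).indicator fun _ => (1 : ℝ)) (spectrum ℝ H) := by
    intro x hx
    refine HasDiscreteFrontier.continuousOn_indicator fun y hy => ?_
    rw [(frontier_subset_closure.trans_eq isClosed_singleton.closure_eq) hy]
    exact eventually_not_mem_spectrum hH (hmem x hx)
  have e : spectralProj H (Set.Icc a b) = ∑ x ∈ hfin.toFinset, spectralProj H {x} := by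
    simp only [spectralProj]
    rw [← cfc_sum _ H _ hcont]
    refine cfc_congr fun y hy => ?_
    simp [Finset.sum_apply, Set.indicator_apply, hfin.mem_toFinset, hy]
  rw [e]
  have hs : ∀ t : Finset ℝ, (∀ x ∈ t, (x : ℂ) ∉ essSpectrum H) →
      (∑ x ∈ t, spectralProj H {x}).toLinearMap.HasFiniteRange := by
    intro t
    induction t using Finset.induction_on with
    | empty => intro _; exact LinearMap.HasFiniteRange.zero
    | insert a t ha ih =>
      intro ht
      rw [Finset.sum_insert ha]
      exact (hasFiniteRange_spectralProj_singleton hH (ht a (Finset.mem_insert_self a t))).add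
        (ih fun x hx => ht x (Finset.mem_insert_of_mem hx))
  exact hs _ hmem

/-- The functional calculus respects compact differences. -/
theorem isCompactOperator_cfc_sub (hH : IsSelfAdjoint H) (hH' : IsSelfAdjoint H')
    (h : IsCompactOperator (H - H')) {f : ℝ → ℝ}
    (hf : ContinuousOn f (spectrum ℝ H)) (hf' : ContinuousOn f (spectrum ℝ H')) :
    IsCompactOperator (cfc (p := IsSelfAdjoint) f H - cfc (p := IsSelfAdjoint) f H') := by
  -- One compact set carries both functional calculi, so that a single approximation of `f` serves
  -- `H` and `H'` together.
  set s := spectrum ℝ H ∪ spectrum ℝ H'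
  have hs : IsCompact s := (spectrum.isCompact H).union (spectrum.isCompact H')
  have hfs : ContinuousOn f s :=
    hf.union_of_isClosed hf' (spectrum.isClosed H) (spectrum.isClosed H')
  have : CompactSpace s := isCompact_iff_compactSpace.1 hs
  have h1 : spectrum ℝ H ⊆ s := Set.subset_union_left
  have h2 : spectrum ℝ H' ⊆ s := Set.subset_union_right
  have key : ∀ g : C(s, ℝ), IsCompactOperator
      (cfcHomSuperset (p := IsSelfAdjoint) hH h1 g -
        cfcHomSuperset (p := IsSelfAdjoint) hH' h2 g) := by
    intro g
    -- Stone–Weierstrass: the property holds for constants and the identity, passes to sums and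
    -- products, and survives uniform limits because the compact operators are norm closed.
    induction g using ContinuousMap.induction_on_of_compact with
    | const r =>
      have : ContinuousMap.const s r = algebraMap ℝ C(s, ℝ) r := rfl
      simp only [this, AlgHomClass.commutes, sub_self]
      exact isCompactOperator_zero
    | id => simpa only [cfcHomSuperset_id] using h
    | star_id => simpa only [star_trivial, cfcHomSuperset_id] using h
    | add f g hf hg =>
      simp only [map_add, add_sub_add_comm]
      exact hf.add hg
    | mul f g hf hg =>
      have e : ∀ a b a' b' : E →L[ℂ] E, a * b - a' * b' = (a - a') * b + a' * (b - b') := by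
        intros; noncomm_ring
      simp only [map_mul, e]
      exact (hf.mul_right _).add (hg.mul_left _)
    | frequently f hf =>
      refine hf.mem_of_closed ?_
      refine (isClosed_setOfPred_isCompactOperator (𝕜₁ := ℂ) (σ₁₂ := RingHom.id ℂ) (M₁ := E)
        (M₂ := E)).preimage (f := fun g : C(s, ℝ) =>
          cfcHomSuperset (p := IsSelfAdjoint) hH h1 g -
            cfcHomSuperset (p := IsSelfAdjoint) hH' h2 g) ?_
      exact (cfcHomSuperset_continuous hH h1).sub (cfcHomSuperset_continuous hH' h2)
  have e : ∀ (K : E →L[ℂ] E) (hK : IsSelfAdjoint K) (hKs : spectrum ℝ K ⊆ s),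
      cfc (p := IsSelfAdjoint) f K =
        cfcHomSuperset (p := IsSelfAdjoint) hK hKs ⟨_, hfs.domRestrict⟩ := by
    intro K hK hKs
    rw [cfcHomSuperset_apply, cfc_apply _ _ hK (hfs.mono hKs)]
    congr!
  rw [e H hH h1, e H' hH' h2]
  exact key _

theorem isCompactOperator_spectralProj_sub (hH : IsSelfAdjoint H) (hH' : IsSelfAdjoint H')
    (h : IsCompactOperator (H - H')) (hs : HasDiscreteFrontier H s)
    (hs' : HasDiscreteFrontier H' s) :
    IsCompactOperator (spectralProj H s - spectralProj H' s) :=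
  isCompactOperator_cfc_sub hH hH' h hs.continuousOn_indicator hs'.continuousOn_indicator

theorem cfc_unitary_conj (hH : IsSelfAdjoint H) (U : unitary (E →L[ℂ] E)) {f : ℝ → ℝ}
    (hf : ContinuousOn f (spectrum ℝ H)) :
    cfc (p := IsSelfAdjoint) f ((U : E →L[ℂ] E) * H * star (U : E →L[ℂ] E)) =
      (U : E →L[ℂ] E) * cfc (p := IsSelfAdjoint) f H * star (U : E →L[ℂ] E) := by
  have hc : Continuous (Unitary.conjStarAlgAut ℂ (E →L[ℂ] E) U) := by
    change Continuous fun x => (U : E →L[ℂ] E) * x * star (U : E →L[ℂ] E)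
    fun_prop
  have h := StarAlgHomClass.map_cfc (S := ℂ) (p := IsSelfAdjoint) (q := IsSelfAdjoint)
    (Unitary.conjStarAlgAut ℂ (E →L[ℂ] E) U) f H hf hc hH (hH.map _)
  simpa only [Unitary.conjStarAlgAut_apply] using h.symm

theorem spectrum_unitary_conj (U : unitary (E →L[ℂ] E)) (H : E →L[ℂ] E) :
    spectrum ℝ ((U : E →L[ℂ] E) * H * star (U : E →L[ℂ] E)) = spectrum ℝ H := by
  rw [← Unitary.conjStarAlgAut_apply (S := ℝ)]
  exact AlgEquiv.spectrum_eq (Unitary.conjStarAlgAut ℝ (E →L[ℂ] E) U) H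

theorem HasDiscreteFrontier.unitary_conj (h : HasDiscreteFrontier H s)
    (U : unitary (E →L[ℂ] E)) :
    HasDiscreteFrontier ((U : E →L[ℂ] E) * H * star (U : E →L[ℂ] E)) s := by
  intro c hc
  rw [spectrum_unitary_conj]
  exact h c hc

theorem spectralProj_unitary_conj (hH : IsSelfAdjoint H) (U : unitary (E →L[ℂ] E))
    (hs : HasDiscreteFrontier H s) :
    spectralProj ((U : E →L[ℂ] E) * H * star (U : E →L[ℂ] E)) s =
      (U : E →L[ℂ] E) * spectralProj H s * star (U : E →L[ℂ] E) :=
  cfc_unitary_conj hH U hs.continuousOn_indicator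

/-- The indicator is continuous off `c`, and `c` avoids all the spectra. At the level `μ` itself
eigenvalues may cross, which is why auxiliary levels above `μ` are used. -/
theorem continuousOn_spectralProj_Iic {X : Type*} [TopologicalSpace X] {T : X → E →L[ℂ] E}
    {t : Set X} (hT : ContinuousOn T t) (hsa : ∀ x ∈ t, IsSelfAdjoint (T x)) {c : ℝ}
    (hc : ∀ x ∈ t, c ∉ spectrum ℝ (T x)) :
    ContinuousOn (fun x => spectralProj (T x) (Set.Iic c)) t := by
  refine ContinuousOn.cfc_of_mem_nhdsSet (s := {c}ᶜ) _ ?_ hT hsa ?_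
  · refine isOpen_compl_singleton.mem_nhdsSet.2 (Set.iUnion₂_subset fun x hx y hy => ?_)
    rintro rfl
    exact hc x hx hy
  · intro y hy
    refine (continuousOn_const.continuousAt_indicator ?_).continuousWithinAt
    rwa [frontier_Iic]

end SpectralProj

/-! ### Spectral flow between unitarily equivalent operators -/

section Flow

variable {E : Type*} [NormedAddCommGroup E] [InnerProductSpace ℂ E] [CompleteSpace E]

theorem continuousOn_of_eventually_eq {X Y : Type*} [TopologicalSpace X] [TopologicalSpace Y]
    {f : X → Y} {t : Set X} (h : ∀ x ∈ t, ∀ᶠ y in 𝓝[t] x, f y = f x) : ContinuousOn f t :=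
  fun x hx => tendsto_const_nhds.congr' ((h x hx).mono fun _ hy => hy.symm)

omit [CompleteSpace E] in
theorem ContinuousOn.eventually_norm_sub_lt {X : Type*} [TopologicalSpace X] {P : X → E →L[ℂ] E}
    {t : Set X} (hP : ContinuousOn P t) {x : X} (hx : x ∈ t) : ∀ᶠ y in 𝓝[t] x, ‖P x - P y‖ < 1 := by
  have h := (hP x hx).eventually (Metric.ball_mem_nhds (P x) one_pos)
  filter_upwards [h] with y hy
  rwa [norm_sub_rev, ← dist_eq_norm]

/-- By additivity `s ↦ relIndex (P a) (P s)` is locally constant, as projections at distance less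
than one have relative index zero. -/
theorem relIndex_eq_zero_of_continuousOn {P : ℝ → E →L[ℂ] E} {a b : ℝ} (hab : a ≤ b)
    (hP : ContinuousOn P (Set.Icc a b)) (hproj : ∀ s ∈ Set.Icc a b, IsStarProjection (P s))
    (hc : ∀ s ∈ Set.Icc a b, ∀ s' ∈ Set.Icc a b, IsCompactOperator (P s - P s')) :
    relIndex (P a) (P b) = 0 := by
  have ha := Set.left_mem_Icc.2 hab
  have hcont : ContinuousOn (fun s => relIndex (P a) (P s)) (Set.Icc a b) := by
    refine continuousOn_of_eventually_eq fun s hs => ?_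
    filter_upwards [hP.eventually_norm_sub_lt hs, self_mem_nhdsWithin] with s' h hs'
    rw [relIndex_trans (hproj a ha).1 (hproj s hs).1 (hproj s' hs').1 (hc a ha s hs)
      (hc s hs s' hs'), relIndex_eq_zero_of_norm_sub_lt (hproj s hs).1 (hproj s' hs').1
      ((hproj s hs).norm_le) ((hproj s' hs').norm_le) h, add_zero]
  rw [← isPreconnected_Icc.constant hcont ha (Set.right_mem_Icc.2 hab)]
  exact relIndex_self (hproj a ha).1

section Projections

variable {H : E →L[ℂ] E} {μ c : ℝ}

theorem spectralProj_Iic_sub_Iio (hμ : ∀ᶠ y in 𝓝[≠] μ, y ∉ spectrum ℝ H)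
    (hc : ∀ᶠ y in 𝓝[≠] c, y ∉ spectrum ℝ H) (hμc : μ ≤ c) :
    spectralProj H (Set.Iic c) - spectralProj H (Set.Iio μ) = spectralProj H (Set.Icc μ c) := by
  rw [spectralProj_sub (hasDiscreteFrontier_Iic hc) (hasDiscreteFrontier_Iio hμ)
    (fun x hx => (le_of_lt hx).trans hμc)]
  congr 1
  ext x
  simp

/-- Turns the eigenvalue counts in the definition of the flow into relative indices, which are
additive. -/
theorem relIndex_spectralProj (hμ : ∀ᶠ y in 𝓝[≠] μ, y ∉ spectrum ℝ H)
    (hc : ∀ᶠ y in 𝓝[≠] (μ + c), y ∉ spectrum ℝ H) (h0 : 0 ≤ c) :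
    relIndex (spectralProj H (Set.Iic (μ + c))) (spectralProj H (Set.Iio μ)) =
      eigenCount H μ c := by
  have hL := hasDiscreteFrontier_Iio hμ
  have hR := hasDiscreteFrontier_Iic hc
  have hsub : Set.Iio μ ⊆ Set.Iic (μ + c) := fun x hx =>
    (le_of_lt hx).trans (le_add_of_nonneg_right h0)
  rw [relIndex_of_le (isStarProjection_spectralProj hL).1 (isStarProjection_spectralProj hR).1
    (by rw [spectralProj_mul hR hL, Set.inter_eq_right.2 hsub])
    (by rw [spectralProj_mul hL hR, Set.inter_eq_left.2 hsub]),
    spectralProj_Iic_sub_Iio hμ hc (le_add_of_nonneg_right h0)]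
  rfl

theorem isCompactOperator_spectralProj_Iic_sub_Iio (hH : IsSelfAdjoint H)
    (hess : ∀ x ∈ Set.Icc μ c, (x : ℂ) ∉ essSpectrum H) (hμc : μ ≤ c) :
    IsCompactOperator (spectralProj H (Set.Iic c) - spectralProj H (Set.Iio μ)) := by
  rw [spectralProj_Iic_sub_Iio (eventually_not_mem_spectrum hH (hess μ (Set.left_mem_Icc.2 hμc)))
    (eventually_not_mem_spectrum hH (hess c (Set.right_mem_Icc.2 hμc))) hμc]
  exact isCompactOperator_of_hasFiniteRange (hasFiniteRange_spectralProj_Icc hH hess)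

/-- Here `[U, P] = (U P U* - P) U`, and `U P U*` is the spectral projection of `U H U*`, a compact
perturbation of `H`. -/
theorem isCompactOperator_commutator (hH : IsSelfAdjoint H) {U : unitary (E →L[ℂ] E)}
    (hU : IsCompactOperator ((U : E →L[ℂ] E) * H * star (U : E →L[ℂ] E) - H)) {s : Set ℝ}
    (hs : HasDiscreteFrontier H s) :
    IsCompactOperator ((U : E →L[ℂ] E) * spectralProj H s - spectralProj H s * (U : E →L[ℂ] E)) := by
  have h := isCompactOperator_spectralProj_sub (hH.conjugate (U : E →L[ℂ] E)) hH hU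
    (hs.unitary_conj U) hs
  rw [spectralProj_unitary_conj hH U hs] at h
  convert! h.mul_right (U : E →L[ℂ] E) using 2
  rw [sub_mul, mul_assoc _ (star (U : E →L[ℂ] E)), Unitary.coe_star_mul_self, mul_one]

/-- The index of the compression of `U` to a spectral projection of `H` does not depend on the
choice of the Fermi level within an interval free of essential spectrum. -/
theorem index_block_Iic_eq_Iio (hH : IsSelfAdjoint H) {U : unitary (E →L[ℂ] E)}
    (hU : IsCompactOperator ((U : E →L[ℂ] E) * H * star (U : E →L[ℂ] E) - H))
    (hess : ∀ x ∈ Set.Icc μ c, (x : ℂ) ∉ essSpectrum H) (hμc : μ ≤ c) :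
    (block (spectralProj H (Set.Iic c)) (spectralProj H (Set.Iic c))
        (U : E →L[ℂ] E)).toLinearMap.index =
      (block (spectralProj H (Set.Iio μ)) (spectralProj H (Set.Iio μ))
        (U : E →L[ℂ] E)).toLinearMap.index := by
  have hL := hasDiscreteFrontier_Iio
    (eventually_not_mem_spectrum hH (hess μ (Set.left_mem_Icc.2 hμc)))
  have hR := hasDiscreteFrontier_Iic
    (eventually_not_mem_spectrum hH (hess c (Set.right_mem_Icc.2 hμc)))
  exact index_block_eq_of_isCompactOperator_sub (isStarProjection_spectralProj hL).1
    (isStarProjection_spectralProj hR).1 (Unitary.coe_mul_star_self U)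
    (Unitary.coe_star_mul_self U) (isCompactOperator_commutator hH hU hL)
    (isCompactOperator_spectralProj_Iic_sub_Iio hH hess hμc).sub_rev

end Projections

/-- The relative index of `P` and `U P U*` is the negative of the index of `P U P`. -/
theorem relIndex_unitary_conj {P : E →L[ℂ] E} (hP : IsIdempotentElem P) {U : unitary (E →L[ℂ] E)}
    (h : IsCompactOperator ((U : E →L[ℂ] E) * P - P * (U : E →L[ℂ] E))) :
    relIndex P ((U : E →L[ℂ] E) * P * star (U : E →L[ℂ] E)) =
      -(block P P (U : E →L[ℂ] E)).toLinearMap.index := by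
  set u : E →L[ℂ] E := (U : E →L[ℂ] E)
  have h1 : u * star u = 1 := Unitary.coe_mul_star_self U
  have h2 : star u * u = 1 := Unitary.coe_star_mul_self U
  have h2' : ∀ X, star u * (u * X) = X := fun X => by rw [← mul_assoc, h2, one_mul]
  have hP' : ∀ X, P * (P * X) = P * X := fun X => by rw [← mul_assoc, hP.eq]
  set Q := u * P * star u with hQ
  have hQi : IsIdempotentElem Q := by
    simp only [IsIdempotentElem, hQ, mul_assoc, h2', hP']
  have hPQ : IsCompactOperator (P - Q) := by
    convert! (h.mul_right (star u)).neg using 1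
    have e : (u * P - P * u) * star u = Q - P := by
      rw [sub_mul, mul_assoc P, h1, mul_one]
    rw [e, ← FunLike.coe_neg, neg_sub]
  have hW : HasIndex (block Q P (star u)) 0 := by
    refine hasIndex_zero_of_comp_eq_id (S := block P Q u) ?_ ?_
    · rw [block_comp hP]
      refine block_self_of_mul_mul_eq hQi ?_
      simp only [hQ, mul_assoc, h2', hP']
    · rw [block_comp hQi]
      refine block_self_of_mul_mul_eq hP ?_
      simp only [hQ, mul_assoc, h2', hP', hP.eq]
  have hF := (isFredholm_block_of_commutator hP h1 h2 h).hasIndex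
  -- Apply `P U P`, then pass from `ran P` to `ran Q`, then return by the isomorphism `U*`. The
  -- result is `1 + compact` on `ran P`, so the index of `P U P` and the relative index add up to
  -- zero.
  have h3 := (hW.comp (hasIndex_relIndex hP hQi hPQ)).comp hF
  rw [block_comp hQi, block_comp hP] at h3
  have h4 := h3.block_of_sub (B := P) hP hP ?_
  · rw [block_self_of_mul_mul_eq hP (by rw [hP.eq, hP.eq])] at h4
    have := h4.unique HasIndex.id
    linarith
  · convert! ((h.mul_left (P * star u)).mul_right P) using 2
    simp only [hQ, mul_sub, sub_mul, mul_assoc, h2', hP', hP.eq, mul_one]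

/-- The passage from `χ(T a < μ)` to `χ(T b < μ)` goes through the projections at level `μ + c`.
That level stays in the resolvent set, so the middle link contributes zero; the outer links
contribute the two eigenvalue counts with opposite signs. -/
theorem relIndex_spectralProj_Iio {T : ℝ → E →L[ℂ] E} (hT : Continuous T)
    (hsa : ∀ s, IsSelfAdjoint (T s)) (hcomp : ∀ s, IsCompactOperator (T s - T 0))
    {μ a b c : ℝ} (hab : a ≤ b) (hc : 0 < c)
    (h : ∀ s ∈ Set.Icc a b, μ + c ∉ spectrum ℝ (T s) ∧
      ∀ x ∈ Set.Icc (μ - c) (μ + c), (x : ℂ) ∉ essSpectrum (T s)) :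
    relIndex (spectralProj (T a) (Set.Iio μ)) (spectralProj (T b) (Set.Iio μ)) =
      eigenCount (T b) μ c - eigenCount (T a) μ c := by
  have hcomp' : ∀ s s', IsCompactOperator (T s - T s') := fun s s' => by
    simpa using (hcomp s).sub (hcomp s')
  have ha := Set.left_mem_Icc.2 hab
  have hb := Set.right_mem_Icc.2 hab
  have hμ : ∀ s ∈ Set.Icc a b, ∀ᶠ y in 𝓝[≠] μ, y ∉ spectrum ℝ (T s) := fun s hs =>
    eventually_not_mem_spectrum (hsa s) ((h s hs).2 μ ⟨by linarith, by linarith⟩)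
  have hμc : ∀ s ∈ Set.Icc a b, ∀ᶠ y in 𝓝[≠] (μ + c), y ∉ spectrum ℝ (T s) := fun s hs =>
    eventually_not_mem_spectrum_of_not_mem (h s hs).1
  have hL : ∀ s ∈ Set.Icc a b, IsIdempotentElem (spectralProj (T s) (Set.Iio μ)) := fun s hs =>
    (isStarProjection_spectralProj (hasDiscreteFrontier_Iio (hμ s hs))).1
  have hR : ∀ s ∈ Set.Icc a b, IsStarProjection (spectralProj (T s) (Set.Iic (μ + c))) :=
    fun s hs => isStarProjection_spectralProj (hasDiscreteFrontier_Iic (hμc s hs))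
  have hRL : ∀ s ∈ Set.Icc a b, IsCompactOperator
      (spectralProj (T s) (Set.Iic (μ + c)) - spectralProj (T s) (Set.Iio μ)) := fun s hs =>
    isCompactOperator_spectralProj_Iic_sub_Iio (hsa s)
      (fun x hx => (h s hs).2 x ⟨by linarith [hx.1], hx.2⟩) (by linarith)
  have hRR : ∀ s ∈ Set.Icc a b, ∀ s' ∈ Set.Icc a b, IsCompactOperator
      (spectralProj (T s) (Set.Iic (μ + c)) - spectralProj (T s') (Set.Iic (μ + c))) :=
    fun s hs s' hs' => isCompactOperator_spectralProj_sub (hsa s) (hsa s') (hcomp' s s')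
      (hasDiscreteFrontier_Iic (hμc s hs)) (hasDiscreteFrontier_Iic (hμc s' hs'))
  have hzero : relIndex (spectralProj (T a) (Set.Iic (μ + c)))
      (spectralProj (T b) (Set.Iic (μ + c))) = 0 :=
    relIndex_eq_zero_of_continuousOn (P := fun s => spectralProj (T s) (Set.Iic (μ + c))) hab
      (continuousOn_spectralProj_Iic hT.continuousOn (fun s _ => hsa s) fun s hs => (h s hs).1)
      hR hRR
  have hRaLb : IsCompactOperator
      (spectralProj (T a) (Set.Iic (μ + c)) - spectralProj (T b) (Set.Iio μ)) := by
    simpa using (hRR a ha b hb).add (hRL b hb)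
  rw [relIndex_trans (hL a ha) (hR a ha).1 (hL b hb) (hRL a ha).sub_rev hRaLb,
    relIndex_trans (hR a ha).1 (hR b hb).1 (hL b hb) (hRR a ha b hb) (hRL b hb), hzero,
    relIndex_symm (hL a ha) (hR a ha).1 (hRL a ha).sub_rev,
    relIndex_spectralProj (hμ a ha) (hμc a ha) hc.le,
    relIndex_spectralProj (hμ b hb) (hμc b hb) hc.le]
  ring

/-- For each `s` some arbitrarily small `c` has `μ ± c` outside the spectrum of `T s`, and this
persists near `s`; compactness of `[0,1]` does the rest. The bound `c < ε` is uniform because the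
essential spectrum of `T s` lies in that of `T 0`. -/
theorem exists_isFlowSubdivision {T : ℝ → E →L[ℂ] E} (hT : Continuous T)
    (hsa : ∀ s, IsSelfAdjoint (T s)) (hcomp : ∀ s, IsCompactOperator (T s - T 0)) {μ : ℝ}
    (hμ : (μ : ℂ) ∉ essSpectrum (T 0)) :
    ∃ (N : ℕ) (τ a : ℕ → ℝ), IsFlowSubdivision T μ N τ a := by
  have hess : ∀ s, essSpectrum (T s) ⊆ essSpectrum (T 0) := fun s =>
    essSpectrum_subset_of_isCompactOperator_sub (hcomp s)
  have hμs : ∀ s, (μ : ℂ) ∉ essSpectrum (T s) := fun s h => hμ (hess s h)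
  have h0 : ∀ᶠ x : ℝ in 𝓝 μ, (x : ℂ) ∉ essSpectrum (T 0) := by
    have hc : ContinuousAt (fun x : ℝ => (T 0, x)) μ := by fun_prop
    exact hc.eventually (eventually_not_mem_essSpectrum (hsa 0) hμ)
  obtain ⟨ε, hε, hball⟩ := Metric.eventually_nhds_iff_ball.1 h0
  have hloc : ∀ s, ∃ c, 0 < c ∧ c < ε ∧ μ - c ∉ spectrum ℝ (T s) ∧ μ + c ∉ spectrum ℝ (T s) := by
    intro s
    have h1 := eventually_not_mem_spectrum (hsa s) (hμs s)
    have t1 : Tendsto (fun c : ℝ => μ - c) (𝓝[>] 0) (𝓝[≠] μ) := by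
      refine tendsto_nhdsWithin_iff.2 ⟨?_, ?_⟩
      · have : ContinuousAt (fun c : ℝ => μ - c) 0 := by fun_prop
        simpa [ContinuousAt] using this.tendsto.mono_left nhdsWithin_le_nhds
      · filter_upwards [self_mem_nhdsWithin] with c hc
        have hc : 0 < c := hc
        simpa using hc.ne'
    have t2 : Tendsto (fun c : ℝ => μ + c) (𝓝[>] 0) (𝓝[≠] μ) := by
      refine tendsto_nhdsWithin_iff.2 ⟨?_, ?_⟩
      · have : ContinuousAt (fun c : ℝ => μ + c) 0 := by fun_prop
        simpa [ContinuousAt] using this.tendsto.mono_left nhdsWithin_le_nhds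
      · filter_upwards [self_mem_nhdsWithin] with c hc
        have hc : 0 < c := hc
        simpa using hc.ne'
    have h2 : ∀ᶠ c in 𝓝[>] (0 : ℝ), c < ε := nhdsWithin_le_nhds (Iio_mem_nhds hε)
    obtain ⟨c, hc1, hc2, hc3, hc4⟩ := ((t1.eventually h1).and ((t2.eventually h1).and
      (h2.and self_mem_nhdsWithin))).exists
    exact ⟨c, hc4, hc3, hc1, hc2⟩
  choose c hc0 hcε hc1 hc2 using hloc
  have hopen : ∀ x : ℝ, IsOpen {s | x ∉ spectrum ℝ (T s)} := by
    intro x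
    simp only [not_mem_spectrum_real_iff]
    exact Units.isOpen.preimage (by fun_prop : Continuous fun s => T s - (x : ℂ) • (1 : E →L[ℂ] E))
  obtain ⟨τ, h1, h2, ⟨N, hN⟩, h3⟩ := exists_monotone_Icc_subset_open_cover_Icc
    (zero_le_one (α := ℝ)) (ι := ℝ) (c := fun r => Subtype.val ⁻¹'
      ({s | μ - c r ∉ spectrum ℝ (T s)} ∩ {s | μ + c r ∉ spectrum ℝ (T s)}))
    (fun r => ((hopen _).inter (hopen _)).preimage continuous_subtype_val)
    (fun s _ => Set.mem_iUnion.2 ⟨s, hc1 s, hc2 s⟩)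
  choose r hr using h3
  refine ⟨N, fun n => τ n, fun n => c (r n), h1, by simp [hN N le_rfl], fun i _ =>
    ⟨h2 i.le_succ, hc0 _, fun s hs => ?_⟩⟩
  have hs01 : s ∈ Set.Icc (0 : ℝ) 1 := ⟨(τ i).2.1.trans hs.1, hs.2.trans (τ (i + 1)).2.2⟩
  have hs' : (⟨s, hs01⟩ : Set.Icc (0 : ℝ) 1) ∈ Set.Icc (τ i) (τ (i + 1)) := hs
  refine ⟨(hr i hs').1, (hr i hs').2, fun x hx hxess => hball x ?_ (hess s hxess)⟩
  rw [Metric.mem_ball, Real.dist_eq, abs_lt]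
  constructor <;> linarith [hx.1, hx.2, hcε (r i)]

end Flow

/-! ### Index formula and homotopy invariance for abstract operators -/

section Main

variable {E : Type*} [NormedAddCommGroup E] [InnerProductSpace ℂ E] [CompleteSpace E]

theorem isFredholm_compression {H : E →L[ℂ] E} (hH : IsSelfAdjoint H) {U : unitary (E →L[ℂ] E)}
    (hU : IsCompactOperator ((U : E →L[ℂ] E) * H * star (U : E →L[ℂ] E) - H)) {μ : ℝ}
    (hμ : (μ : ℂ) ∉ essSpectrum H) :
    (compression (spectralProj H (Set.Iic μ)) (U : E →L[ℂ] E)).IsFredholm := by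
  have hs := hasDiscreteFrontier_Iic (eventually_not_mem_spectrum hH hμ)
  exact isFredholm_block_of_commutator (isStarProjection_spectralProj hs).1
    (Unitary.coe_mul_star_self U) (Unitary.coe_star_mul_self U)
    (isCompactOperator_commutator hH hU hs)

/-- The spectral flow of a path from `T 0` to `U (T 0) U*` within compact perturbations of `T 0`
is the negative of the index of the compression of `U` to the spectral projection of `T 0`. -/
theorem hasSpectralFlow_of_unitary_conj {T : ℝ → E →L[ℂ] E} (hT : Continuous T)
    (hsa : ∀ s, IsSelfAdjoint (T s)) (hcomp : ∀ s, IsCompactOperator (T s - T 0))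
    {U : unitary (E →L[ℂ] E)} (hU : T 1 = (U : E →L[ℂ] E) * T 0 * star (U : E →L[ℂ] E)) {μ : ℝ}
    (hμ : (μ : ℂ) ∉ essSpectrum (T 0)) :
    HasSpectralFlow T μ
      (-fredholmIndex (compression (spectralProj (T 0) (Set.Iic μ)) (U : E →L[ℂ] E))) := by
  refine ⟨hT.continuousOn, fun s _ => hsa s, exists_isFlowSubdivision hT hsa hcomp hμ, ?_⟩
  rintro N τ a ⟨hτ0, hτN, h⟩
  have hμs : ∀ s, (μ : ℂ) ∉ essSpectrum (T s) := fun s h =>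
    hμ (essSpectrum_subset_of_isCompactOperator_sub (hcomp s) h)
  have hd : ∀ s, HasDiscreteFrontier (T s) (Set.Iio μ) := fun s =>
    hasDiscreteFrontier_Iio (eventually_not_mem_spectrum (hsa s) (hμs s))
  have hproj : ∀ s, IsIdempotentElem (spectralProj (T s) (Set.Iio μ)) := fun s =>
    (isStarProjection_spectralProj (hd s)).1
  have hLL : ∀ s s', IsCompactOperator
      (spectralProj (T s) (Set.Iio μ) - spectralProj (T s') (Set.Iio μ)) := fun s s' =>
    isCompactOperator_spectralProj_sub (hsa s) (hsa s')
      (by simpa using (hcomp s).sub (hcomp s')) (hd s) (hd s')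
  have hstep : ∀ i < N, relIndex (spectralProj (T (τ i)) (Set.Iio μ))
      (spectralProj (T (τ (i + 1))) (Set.Iio μ)) =
        eigenCount (T (τ (i + 1))) μ (a i) - eigenCount (T (τ i)) μ (a i) := fun i hi =>
    relIndex_spectralProj_Iio hT hsa hcomp (h i hi).1 (h i hi).2.1
      fun s hs => ((h i hi).2.2 s hs).2
  have hsum : ∀ n ≤ N, ∑ i ∈ Finset.range n,
      (eigenCount (T (τ (i + 1))) μ (a i) - eigenCount (T (τ i)) μ (a i)) =
        relIndex (spectralProj (T (τ 0)) (Set.Iio μ)) (spectralProj (T (τ n)) (Set.Iio μ)) := by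
    intro n
    induction n with
    | zero => intro _; rw [Finset.sum_range_zero, relIndex_self (hproj _)]
    | succ n ih =>
      intro hn
      rw [Finset.sum_range_succ, ih (by omega), ← hstep n (by omega),
        ← relIndex_trans (hproj _) (hproj _) (hproj _) (hLL _ _) (hLL _ _)]
  have hU' : IsCompactOperator ((U : E →L[ℂ] E) * T 0 * star (U : E →L[ℂ] E) - T 0) := by
    rw [← hU]
    exact hcomp 1
  -- The counts over `[μ, μ + a]` lead to `Iio μ`, while the Fermi projection uses `Iic μ`; the
  -- degenerate interval `[μ, μ]` bridges the two.
  rw [hsum N le_rfl, hτ0, hτN, hU, spectralProj_unitary_conj (hsa 0) U (hd 0),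
    relIndex_unitary_conj (hproj 0) (isCompactOperator_commutator (hsa 0) hU' (hd 0)),
    ← index_block_Iic_eq_Iio (hsa 0) hU' (c := μ) (fun x hx => ?_) le_rfl]
  · rfl
  · rwa [le_antisymm hx.2 hx.1]

/-- The index of the compression of `U` to the Fermi projections of a continuous family is
constant, as long as the Fermi level stays outside the essential spectrum. -/
theorem continuousOn_index_compression {H : ℝ → E →L[ℂ] E} (hH : Continuous H)
    (hsa : ∀ s, IsSelfAdjoint (H s)) {U : unitary (E →L[ℂ] E)}
    (hU : ∀ s, IsCompactOperator ((U : E →L[ℂ] E) * H s * star (U : E →L[ℂ] E) - H s)) {μ : ℝ}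
    {t : Set ℝ} (hμ : ∀ s ∈ t, (μ : ℂ) ∉ essSpectrum (H s)) :
    ContinuousOn (fun s => fredholmIndex
      (compression (spectralProj (H s) (Set.Iic μ)) (U : E →L[ℂ] E))) t := by
  refine continuousOn_of_eventually_eq fun s hs => nhdsWithin_le_nhds ?_
  have h1 := eventually_not_mem_essSpectrum (hsa s) (hμ s hs)
  rw [nhds_prod_eq, eventually_prod_iff] at h1
  obtain ⟨pa, hpa, pb, hpb, hp⟩ := h1
  obtain ⟨ε, hε, hball⟩ := Metric.eventually_nhds_iff_ball.1 hpb
  -- The level `μ` may be an eigenvalue of `H s`; a level `c` slightly above it lies in a gap, with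
  -- no essential spectrum in between, and both facts persist for nearby parameters.
  obtain ⟨c, ⟨hμc, hcε⟩, hcs⟩ : ∃ c, (μ < c ∧ c < μ + ε) ∧ c ∉ spectrum ℝ (H s) := by
    have h2 : ∀ᶠ y in 𝓝[>] μ, y ∉ spectrum ℝ (H s) :=
      nhdsWithin_mono μ (fun y hy => ne_of_gt hy) (eventually_not_mem_spectrum (hsa s) (hμ s hs))
    have h3 : ∀ᶠ y in 𝓝[>] μ, y < μ + ε := nhdsWithin_le_nhds (Iio_mem_nhds (by linarith))
    have h4 : ∀ᶠ y in 𝓝[>] μ, μ < y := self_mem_nhdsWithin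
    exact ((h4.and h3).and h2).exists
  let n : Set ℝ := {r | c ∉ spectrum ℝ (H r) ∧ ∀ x ∈ Set.Icc μ c, (x : ℂ) ∉ essSpectrum (H r)}
  have hn : n ∈ 𝓝 s := by
    have h2 : ∀ᶠ r in 𝓝 s, c ∉ spectrum ℝ (H r) := by
      simp only [not_mem_spectrum_real_iff] at hcs ⊢
      have hc : Continuous fun r => H r - (c : ℂ) • (1 : E →L[ℂ] E) := by fun_prop
      exact hc.continuousAt.eventually (Units.isOpen.mem_nhds hcs)
    filter_upwards [h2, hH.continuousAt.eventually hpa] with r hr hr'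
    refine ⟨hr, fun x hx => hp hr' (hball x ?_)⟩
    rw [Metric.mem_ball, Real.dist_eq, abs_lt]
    constructor <;> linarith [hx.1, hx.2]
  have hsn : s ∈ n := mem_of_mem_nhds hn
  have hcont : ContinuousOn (fun r => spectralProj (H r) (Set.Iic c)) n :=
    continuousOn_spectralProj_Iic hH.continuousOn (fun r _ => hsa r) fun r hr => hr.1
  have hd : ∀ r ∈ n, HasDiscreteFrontier (H r) (Set.Iic c) := fun r hr =>
    hasDiscreteFrontier_Iic (eventually_not_mem_spectrum_of_not_mem hr.1)
  have hproj : ∀ r ∈ n, IsStarProjection (spectralProj (H r) (Set.Iic c)) := fun r hr =>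
    isStarProjection_spectralProj (hd r hr)
  have hindex : ∀ r ∈ n, fredholmIndex
      (compression (spectralProj (H r) (Set.Iic μ)) (U : E →L[ℂ] E)) =
        (block (spectralProj (H r) (Set.Iic c)) (spectralProj (H r) (Set.Iic c))
          (U : E →L[ℂ] E)).toLinearMap.index := by
    intro r hr
    rw [index_block_Iic_eq_Iio (hsa r) (hU r) hr.2 hμc.le,
      ← index_block_Iic_eq_Iio (hsa r) (hU r) (c := μ) (fun x hx => ?_) le_rfl]
    · rfl
    · exact hr.2 x ⟨hx.1, hx.2.trans hμc.le⟩
  have hlt := hcont.eventually_norm_sub_lt hsn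
  rw [nhdsWithin_eq_nhds.2 hn] at hlt
  filter_upwards [hn, hlt] with r hr hr'
  rw [hindex r hr, hindex s hsn]
  exact index_block_eq_of_norm_sub_lt (hproj s hsn).1 (hproj r hr).1 (hproj s hsn).norm_le
    (hproj r hr).norm_le hr' (Unitary.coe_mul_star_self U) (Unitary.coe_star_mul_self U)
    (isCompactOperator_commutator (hsa s) (hU s) (hd s hsn))
    (isCompactOperator_commutator (hsa r) (hU r) (hd r hr))

end Main

/-! ### The Aharonov-Bohm gauge and the Dirac phase -/

/-- The radius carries the sign of `x`, so that one formula covers both half-planes without a choice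
of branch of the argument. -/
theorem mk_eq_mul_exp_arctan {x y : ℝ} (hx : x ≠ 0) :
    (⟨x, y⟩ : ℂ) = ((x * √(1 + (y / x) ^ 2) : ℝ) : ℂ) *
      Complex.exp ((Real.arctan (y / x) : ℝ) * Complex.I) := by
  have h : √(1 + (y / x) ^ 2) ≠ 0 := by positivity
  apply Complex.ext
  · rw [Complex.re_ofReal_mul, Complex.exp_ofReal_mul_I_re, Real.cos_arctan]
    field_simp
  · rw [Complex.im_ofReal_mul, Complex.exp_ofReal_mul_I_im, Real.sin_arctan]
    field_simp

/-- Signed radii of equal sign drop out after normalization. -/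
theorem div_norm_eq_of_polar {z z' u u' c : ℂ} {s s' : ℝ} (hz : z = s * u) (hz' : z' = s' * u')
    (hu : ‖u‖ = 1) (hu' : ‖u'‖ = 1) (hs : 0 < s * s') (hc : u = c * u') :
    z / (‖z‖ : ℂ) = c * (z' / (‖z'‖ : ℂ)) := by
  have h : s / |s| = s' / |s'| := by
    rcases pos_and_pos_or_neg_and_neg_of_mul_pos hs with ⟨h, h'⟩ | ⟨h, h'⟩
    · rw [abs_of_pos h, abs_of_pos h', div_self h.ne', div_self h'.ne']
    · rw [abs_of_neg h, abs_of_neg h', div_neg, div_neg, div_self h.ne, div_self h'.ne]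
  have h' : (s : ℂ) / (|s| : ℝ) = (s' : ℂ) / (|s'| : ℝ) := by exact_mod_cast h
  have hn : ‖z‖ = |s| := by rw [hz, norm_mul, hu, mul_one, Complex.norm_real, Real.norm_eq_abs]
  have hn' : ‖z'‖ = |s'| := by
    rw [hz', norm_mul, hu', mul_one, Complex.norm_real, Real.norm_eq_abs]
  rw [hn, hn', hz, hz', mul_div_right_comm, h', mul_div_right_comm, hc]
  ring

theorem relPos_re_ne_zero (m n : Site) : (relPos m n).re ≠ 0 := by
  intro h
  have h1 : (n.1 : ℝ) - ((m.1 : ℝ) + 1 / 2) = 0 := h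
  have h2 : ((2 * n.1 - 2 * m.1 - 1 : ℤ) : ℝ) = 0 := by push_cast; linarith
  have h3 : (2 * n.1 - 2 * m.1 - 1 : ℤ) = 0 := by exact_mod_cast h2
  omega

theorem relPos_im_ne_zero (m n : Site) : (relPos m n).im ≠ 0 := by
  intro h
  have h1 : (n.2 : ℝ) - ((m.2 : ℝ) + 1 / 2) = 0 := h
  have h2 : ((2 * n.2 - 2 * m.2 - 1 : ℤ) : ℝ) = 0 := by push_cast; linarith
  have h3 : (2 * n.2 - 2 * m.2 - 1 : ℤ) = 0 := by exact_mod_cast h2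
  omega

theorem relPos_add_unitVec_zero (m n : Site) :
    relPos m (n + unitVec 0) = ⟨(relPos m n).re + 1, (relPos m n).im⟩ := by
  apply Complex.ext <;> simp [relPos, unitVec]
  ring

theorem relPos_add_unitVec_one (m n : Site) :
    relPos m (n + unitVec 1) = ⟨(relPos m n).re, (relPos m n).im + 1⟩ := by
  apply Complex.ext <;> simp [relPos, unitVec]
  ring

theorem abGauge_zero (m : Site) (α : ℝ) (n : Site) : abGauge m α 0 n =
    -α * (Real.arctan (((relPos m n).re + 1) / (relPos m n).im) -
      Real.arctan ((relPos m n).re / (relPos m n).im)) := rfl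

theorem abGauge_one (m : Site) (α : ℝ) (n : Site) : abGauge m α 1 n =
    α * (Real.arctan (((relPos m n).im + 1) / (relPos m n).re) -
      Real.arctan ((relPos m n).im / (relPos m n).re)) := rfl

theorem mul_one_add_sq_pos {x a b : ℝ} (hx : x ≠ 0) :
    0 < x * √(1 + a ^ 2) * (x * √(1 + b ^ 2)) := by
  have h : x * √(1 + a ^ 2) * (x * √(1 + b ^ 2)) = x ^ 2 * (√(1 + a ^ 2) * √(1 + b ^ 2)) := by
    ring
  rw [h]
  positivity

/-- The Aharonov-Bohm gauge for a unit flux is the gradient of the Dirac phase. -/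
theorem diracPhase_eq (m : Site) (j : Fin 2) (n : Site) :
    diracPhase m n = Circle.exp (-abGauge m 1 j n) * diracPhase m (n + unitVec j) := by
  ext
  change -(relPos m n / (‖relPos m n‖ : ℂ)) = (Circle.exp (-abGauge m 1 j n) : ℂ) *
    -(relPos m (n + unitVec j) / (‖relPos m (n + unitVec j)‖ : ℂ))
  rw [mul_neg, neg_inj, Circle.coe_exp]
  have hre := relPos_re_ne_zero m n
  have him := relPos_im_ne_zero m n
  set z := relPos m n
  have hz : z = ⟨z.re, z.im⟩ := rfl
  -- Along a horizontal edge it is the imaginary part that is constant. A quarter turn makes it the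
  -- real part, with angle `arctan (-x / y)`; this produces the minus sign in the first component of
  -- the gauge.
  have hI : ∀ x y : ℝ, (⟨x, y⟩ : ℂ) = ⟨y, -x⟩ * Complex.I := fun x y => by
    apply Complex.ext <;> simp
  fin_cases j
  · change z / _ = Complex.exp ((-abGauge m 1 0 n : ℝ) * Complex.I) *
      (relPos m (n + unitVec 0) / (‖relPos m (n + unitVec 0)‖ : ℂ))
    rw [abGauge_zero, relPos_add_unitVec_zero]
    refine div_norm_eq_of_polar (s := z.im * √(1 + (-z.re / z.im) ^ 2))
      (s' := z.im * √(1 + (-(z.re + 1) / z.im) ^ 2))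
      (u := Complex.exp ((Real.arctan (-z.re / z.im) : ℝ) * Complex.I) * Complex.I)
      (u' := Complex.exp ((Real.arctan (-(z.re + 1) / z.im) : ℝ) * Complex.I) * Complex.I)
      ?_ ?_ ?_ ?_ (mul_one_add_sq_pos him) ?_
    · rw [← mul_assoc, ← mk_eq_mul_exp_arctan him, ← hI]
    · rw [← mul_assoc, ← mk_eq_mul_exp_arctan him, ← hI]
    · rw [norm_mul, Complex.norm_exp_ofReal_mul_I, Complex.norm_I, one_mul]
    · rw [norm_mul, Complex.norm_exp_ofReal_mul_I, Complex.norm_I, one_mul]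
    · rw [← mul_assoc, ← Complex.exp_add, neg_div, neg_div, Real.arctan_neg, Real.arctan_neg]
      congr 2
      push_cast
      ring
  · change z / _ = Complex.exp ((-abGauge m 1 1 n : ℝ) * Complex.I) *
      (relPos m (n + unitVec 1) / (‖relPos m (n + unitVec 1)‖ : ℂ))
    rw [abGauge_one, relPos_add_unitVec_one]
    refine div_norm_eq_of_polar (s := z.re * √(1 + (z.im / z.re) ^ 2))
      (s' := z.re * √(1 + ((z.im + 1) / z.re) ^ 2))
      (u := Complex.exp ((Real.arctan (z.im / z.re) : ℝ) * Complex.I))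
      (u' := Complex.exp ((Real.arctan ((z.im + 1) / z.re) : ℝ) * Complex.I))
      ?_ ?_ ?_ ?_ (mul_one_add_sq_pos hre) ?_
    · rw [← mk_eq_mul_exp_arctan hre]
    · rw [← mk_eq_mul_exp_arctan hre]
    · rw [Complex.norm_exp_ofReal_mul_I]
    · rw [Complex.norm_exp_ofReal_mul_I]
    · rw [← Complex.exp_add]
      congr 1
      push_cast
      ring

theorem abGauge_eq_mul (m : Site) (α : ℝ) (j : Fin 2) (n : Site) :
    abGauge m α j n = α * abGauge m 1 j n := by
  fin_cases j
  · simp only [Fin.zero_eta, abGauge_zero]; ring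
  · simp only [Fin.mk_one, abGauge_one]; ring

/-- The bound `π` lets the gauge be recovered from its phase by the principal argument, and is the
Lipschitz constant of the translations in `α`. -/
theorem abs_abGauge_one_lt (m : Site) (j : Fin 2) (n : Site) : |abGauge m 1 j n| < Real.pi := by
  have h : ∀ a b : ℝ, |Real.arctan a - Real.arctan b| < Real.pi := fun a b => by
    rw [abs_lt]
    constructor <;> linarith [Real.arctan_lt_pi_div_two a, Real.arctan_lt_pi_div_two b,
      Real.neg_pi_div_two_lt_arctan a, Real.neg_pi_div_two_lt_arctan b]
  fin_cases j
  · simp only [Fin.zero_eta, abGauge_zero, neg_one_mul, abs_neg, h]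
  · simp only [Fin.mk_one, abGauge_one, one_mul, h]

theorem tendsto_norm_relPos (m : Site) :
    Tendsto (fun n => ‖relPos m n‖) cofinite atTop := by
  have h := tendsto_norm_cocompact_atTop (E := Site)
  rw [cocompact_eq_cofinite] at h
  have hb : ∀ n : Site, ‖n‖ + -‖relPos m 0‖ ≤ ‖relPos m n‖ := by
    intro n
    rw [← sub_eq_add_neg, sub_le_iff_le_add, Prod.norm_def, max_le_iff]
    have h1 := norm_sub_le (relPos m n) (relPos m 0)
    constructor
    · refine le_trans ?_ ((Complex.abs_re_le_norm _).trans h1)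
      simp only [relPos, Int.norm_eq_abs, Complex.sub_re, Prod.fst_zero, Int.cast_zero]
      exact le_of_eq (by ring_nf)
    · refine le_trans ?_ ((Complex.abs_im_le_norm _).trans h1)
      simp only [relPos, Int.norm_eq_abs, Complex.sub_im, Prod.snd_zero, Int.cast_zero]
      exact le_of_eq (by ring_nf)
  exact tendsto_atTop_mono hb (tendsto_atTop_add_const_right _ _ h)

theorem norm_div_norm_sub_le {z w : ℂ} (hz : z ≠ 0) (hw : w ≠ 0) :
    ‖z / (‖z‖ : ℂ) - w / (‖w‖ : ℂ)‖ ≤ 2 * ‖z - w‖ / ‖z‖ := by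
  have hz' : (‖z‖ : ℂ) ≠ 0 := by simpa using hz
  have hw' : (‖w‖ : ℂ) ≠ 0 := by simpa using hw
  have e : z / (‖z‖ : ℂ) - w / (‖w‖ : ℂ) =
      ((z - w) + w / (‖w‖ : ℂ) * ((‖w‖ : ℂ) - ‖z‖)) / (‖z‖ : ℂ) := by
    field_simp
    ring
  have h1 : ‖w / (‖w‖ : ℂ) * ((‖w‖ : ℂ) - ‖z‖)‖ ≤ ‖z - w‖ := by
    rw [norm_mul, norm_div, Complex.norm_real, norm_norm, div_self (norm_ne_zero_iff.2 hw), one_mul,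
      ← Complex.ofReal_sub, Complex.norm_real, norm_sub_rev z]
    exact abs_norm_sub_norm_le w z
  rw [e, norm_div, Complex.norm_real, norm_norm]
  gcongr
  linarith [norm_add_le (z - w) (w / (‖w‖ : ℂ) * ((‖w‖ : ℂ) - ‖z‖))]

/-- The phase is a quotient of Dirac phases at neighbouring sites, hence within `2 / |z|` of `1`.
Since the gauge is less than `π` in modulus, continuity of the argument at `1` transfers the decay
to the gauge itself. -/
theorem tendsto_abGauge_one (m : Site) (j : Fin 2) :
    Tendsto (fun n => abGauge m 1 j n) cofinite (𝓝 0) := by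
  have h1 : Tendsto (fun n => (Circle.exp (-abGauge m 1 j n) : ℂ)) cofinite (𝓝 1) := by
    rw [tendsto_iff_norm_sub_tendsto_zero]
    have hb : ∀ n, ‖(Circle.exp (-abGauge m 1 j n) : ℂ) - 1‖ ≤ 2 * 1 / ‖relPos m n‖ := by
      intro n
      have h' : (Circle.exp (-abGauge m 1 j n) : ℂ) - 1 =
          ((diracPhase m n : ℂ) - diracPhase m (n + unitVec j)) *
            ((diracPhase m (n + unitVec j))⁻¹ : Circle) := by
        rw [sub_mul, ← Circle.coe_mul, ← Circle.coe_mul, mul_inv_cancel, diracPhase_eq m j n,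
          mul_inv_cancel_right, Circle.coe_one]
      have hd : ‖relPos m n - relPos m (n + unitVec j)‖ = 1 := by
        fin_cases j
        · have e : relPos m n - relPos m (n + unitVec 0) = -1 := by
            rw [relPos_add_unitVec_zero]
            apply Complex.ext <;> simp
          simp [e]
        · have e : relPos m n - relPos m (n + unitVec 1) = -Complex.I := by
            rw [relPos_add_unitVec_one]
            apply Complex.ext <;> simp
          simp [e]
      rw [h', norm_mul, Circle.norm_coe, mul_one]
      change ‖-(relPos m n / (‖relPos m n‖ : ℂ)) -
        -(relPos m (n + unitVec j) / (‖relPos m (n + unitVec j)‖ : ℂ))‖ ≤ _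
      rw [neg_sub_neg, norm_sub_rev, ← hd]
      exact norm_div_norm_sub_le (relPos_ne_zero _ _) (relPos_ne_zero _ _)
    exact squeeze_zero (fun _ => norm_nonneg _) hb
      ((tendsto_const_nhds (x := (2 * 1 : ℝ))).div_atTop (tendsto_norm_relPos m))
  have h2 := (Complex.continuousAt_arg Complex.one_mem_slitPlane).tendsto.comp h1
  rw [Complex.arg_one] at h2
  have h3 : ∀ n, -(Complex.arg ∘ fun n => (Circle.exp (-abGauge m 1 j n) : ℂ)) n =
      abGauge m 1 j n := fun n => by
    have := abs_lt.1 (abs_abGauge_one_lt m j n)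
    rw [Function.comp_apply, Circle.arg_exp (by linarith) (by linarith), neg_neg]
  simpa only [h3, neg_zero] using h2.neg

/-! ### Weighted permutations of the lattice -/

theorem norm_weightedPerm_sub_le (e : Site ≃ Site) {w w' : Site → Circle} {C : ℝ} (hC : 0 ≤ C)
    (h : ∀ n, ‖(w n : ℂ) - w' n‖ ≤ C) :
    ‖(weightedPerm e w : LatticeOp) - (weightedPerm e w' : LatticeOp)‖ ≤ C := by
  refine ContinuousLinearMap.opNorm_le_bound _ hC fun f => ?_
  refine (sq_le_sq₀ (norm_nonneg _) (by positivity)).1 ?_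
  have hf : Summable fun n => ‖f n‖ ^ 2 := (memLp_two_iff _).1 (lp.memℓp f)
  have hg : Summable fun n => C ^ 2 * ‖f (e n)‖ ^ 2 :=
    ((e.summable_iff (f := fun n => ‖f n‖ ^ 2)).2 hf).mul_left _
  rw [mul_pow, l2Lattice_norm_sq, l2Lattice_norm_sq, ← e.tsum_eq (fun n => ‖f n‖ ^ 2),
    ← tsum_mul_left]
  refine Summable.tsum_le_tsum (fun n => ?_) ((memLp_two_iff _).1 (lp.memℓp _)) hg
  have he : (((weightedPerm e w : LatticeOp) - (weightedPerm e w' : LatticeOp)) f) n =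
      ((w n : ℂ) - w' n) * f (e n) := (sub_mul _ _ _).symm
  rw [he, norm_mul, mul_pow]
  gcongr
  exact h n

theorem hasFiniteRange_of_support (T : LatticeOp) (s : Finset Site)
    (h : ∀ f : L2Lattice, ∀ n ∉ s, (T f) n = 0) : T.toLinearMap.HasFiniteRange := by
  let ρ : LinearMap.range T.toLinearMap →ₗ[ℂ] (s → ℂ) :=
    { toFun := fun f i => (f : L2Lattice) i
      map_add' := fun _ _ => rfl
      map_smul' := fun _ _ => rfl }
  have hρ : Function.Injective ρ := by
    rintro ⟨_, f, rfl⟩ ⟨_, g, rfl⟩ hfg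
    ext n
    by_cases hn : n ∈ s
    · exact congrFun hfg ⟨n, hn⟩
    · exact (h f n hn).trans (h g n hn).symm
  exact Module.Finite.iff_fg.1 (FiniteDimensional.of_injective ρ hρ)

theorem isCompactOperator_weightedPerm_sub (e : Site ≃ Site) {w w' : Site → Circle}
    (h : Tendsto (fun n => (w n : ℂ) - w' n) cofinite (𝓝 0)) :
    IsCompactOperator ((weightedPerm e w : LatticeOp) - (weightedPerm e w' : LatticeOp)) := by
  classical
  have hcl := isClosed_setOfPred_isCompactOperator (𝕜₁ := ℂ) (σ₁₂ := RingHom.id ℂ)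
    (M₁ := L2Lattice) (M₂ := L2Lattice)
  have hmem : (weightedPerm e w : LatticeOp) - (weightedPerm e w' : LatticeOp) ∈
      closure {f : LatticeOp | IsCompactOperator f} := by
    refine Metric.mem_closure_iff.2 fun ε hε => ?_
    have h1 : {n | ¬ ‖(w n : ℂ) - w' n‖ < ε / 2}.Finite := by
      have := (tendsto_zero_iff_norm_tendsto_zero.1 h).eventually (Iio_mem_nhds (half_pos hε))
      exact eventually_cofinite.1 this
    let s := h1.toFinset
    -- Off a finite set the phases differ by less than `ε / 2`. Replacing `w` by `w'` there costs
    -- that much in norm and leaves a finite rank difference.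
    let v : Site → Circle := fun n => if n ∈ s then w n else w' n
    refine ⟨(weightedPerm e v : LatticeOp) - (weightedPerm e w' : LatticeOp), ?_, ?_⟩
    · refine isCompactOperator_of_hasFiniteRange (hasFiniteRange_of_support _ s fun f n hn => ?_)
      change (v n : ℂ) * f (e n) - (w' n : ℂ) * f (e n) = 0
      simp only [v, if_neg hn, sub_self]
    · rw [dist_eq_norm, sub_sub_sub_cancel_right]
      refine lt_of_le_of_lt (norm_weightedPerm_sub_le e (half_pos hε).le fun n => ?_)
        (half_lt_self hε)
      by_cases hn : n ∈ s
      · simp only [v, if_pos hn, sub_self, norm_zero]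
        positivity
      · simp only [v, if_neg hn]
        have : ¬ ¬ ‖(w n : ℂ) - w' n‖ < ε / 2 := fun h' => hn (h1.mem_toFinset.2 h')
        exact (not_not.1 this).le
  rwa [hcl.closure_eq] at hmem

theorem norm_circleExp_sub_le (a b : ℝ) : ‖(Circle.exp a : ℂ) - Circle.exp b‖ ≤ |a - b| := by
  have h : (Circle.exp a : ℂ) - Circle.exp b =
      (Complex.exp (Complex.I * ((a - b : ℝ) : ℂ)) - 1) * Circle.exp b := by
    rw [sub_mul, one_mul, Circle.coe_exp, Circle.coe_exp, ← Complex.exp_add]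
    congr 2
    push_cast
    ring
  rw [h, norm_mul, Circle.norm_coe, mul_one]
  exact Real.norm_exp_I_mul_ofReal_sub_one_le

/-! ### Magnetic translations -/

theorem continuous_fluxShift (B : ℝ) (m : Site) (j : Fin 2) :
    Continuous fun α => fluxShift B m α j := by
  refine continuous_induced_rng.2 ?_
  refine LipschitzWith.continuous (K := Real.pi.toNNReal) ?_
  refine LipschitzWith.of_dist_le_mul fun α β => ?_
  rw [dist_eq_norm, Real.coe_toNNReal _ Real.pi_pos.le, Real.dist_eq]
  refine norm_weightedPerm_sub_le _ (by positivity) fun n => ?_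
  refine (norm_circleExp_sub_le _ _).trans ?_
  change |-(symGauge B j n + abGauge m α j n) - -(symGauge B j n + abGauge m β j n)| ≤ _
  rw [abGauge_eq_mul m α, abGauge_eq_mul m β]
  have h : -(symGauge B j n + α * abGauge m 1 j n) - -(symGauge B j n + β * abGauge m 1 j n) =
      -(abGauge m 1 j n * (α - β)) := by ring
  rw [h, abs_neg, abs_mul]
  gcongr
  exact (abs_abGauge_one_lt m j n).le

theorem continuous_fluxMonomial (B : ℝ) (m n : Site) :
    Continuous fun α => (fluxMonomial B m α n : LatticeOp) :=
  continuous_subtype_val.comp (((continuous_fluxShift B m 0).zpow n.1).mul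
    ((continuous_fluxShift B m 1).zpow n.2))

/-- Pairs of unitaries with compact difference. -/
def compactDiffSubgroup : Subgroup (unitary LatticeOp × unitary LatticeOp) where
  carrier := {p | IsCompactOperator ((p.1 : LatticeOp) - (p.2 : LatticeOp))}
  one_mem' := by
    change IsCompactOperator ((1 : LatticeOp) - (1 : LatticeOp))
    rw [sub_self]
    exact isCompactOperator_zero
  mul_mem' := by
    rintro ⟨a, a'⟩ ⟨b, b'⟩ h h'
    change IsCompactOperator ((a : LatticeOp) * (b : LatticeOp) - (a' : LatticeOp) * (b' : LatticeOp))
    have e : (a : LatticeOp) * (b : LatticeOp) - (a' : LatticeOp) * (b' : LatticeOp) =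
        ((a : LatticeOp) - (a' : LatticeOp)) * (b : LatticeOp) +
          (a' : LatticeOp) * ((b : LatticeOp) - (b' : LatticeOp)) := by
      rw [sub_mul, mul_sub, sub_add_sub_cancel]
    rw [e]
    exact (IsCompactOperator.mul_right h _).add (IsCompactOperator.mul_left h' _)
  inv_mem' := by
    rintro ⟨a, a'⟩ h
    change IsCompactOperator (((a⁻¹ : unitary LatticeOp) : LatticeOp) -
      ((a'⁻¹ : unitary LatticeOp) : LatticeOp))
    have h1 : ((a⁻¹ : unitary LatticeOp) : LatticeOp) * (a : LatticeOp) = 1 := Unitary.coe_star_mul_self a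
    have h2 : (a' : LatticeOp) * ((a'⁻¹ : unitary LatticeOp) : LatticeOp) = 1 :=
      Unitary.coe_mul_star_self a'
    have e : ((a⁻¹ : unitary LatticeOp) : LatticeOp) - ((a'⁻¹ : unitary LatticeOp) : LatticeOp) =
        -(((a⁻¹ : unitary LatticeOp) : LatticeOp) * ((a : LatticeOp) - (a' : LatticeOp)) *
          ((a'⁻¹ : unitary LatticeOp) : LatticeOp)) := by
      rw [mul_sub, sub_mul, h1, one_mul, mul_assoc, h2, mul_one, neg_sub]
    rw [e]
    exact ((IsCompactOperator.mul_left h _).mul_right _).neg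

theorem mem_compactDiffSubgroup_iff {p : unitary LatticeOp × unitary LatticeOp} :
    p ∈ compactDiffSubgroup ↔ IsCompactOperator ((p.1 : LatticeOp) - (p.2 : LatticeOp)) :=
  Iff.rfl

theorem isCompactOperator_fluxShift_sub (B : ℝ) (m : Site) (α β : ℝ) (j : Fin 2) :
    IsCompactOperator ((fluxShift B m α j : LatticeOp) - (fluxShift B m β j : LatticeOp)) := by
  refine isCompactOperator_weightedPerm_sub _ ?_
  have h1 : Tendsto (fun n => |(β - α) * abGauge m 1 j n|) cofinite (𝓝 0) := by
    simpa using ((tendsto_abGauge_one m j).const_mul (β - α)).abs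
  refine squeeze_zero_norm (fun n => ?_) h1
  refine (norm_circleExp_sub_le _ _).trans (le_of_eq ?_)
  change |-(symGauge B j n + abGauge m α j n) - -(symGauge B j n + abGauge m β j n)| = _
  rw [abGauge_eq_mul m α, abGauge_eq_mul m β]
  ring_nf

/-- Pairs with compact difference form a subgroup, which handles negative exponents together with
positive ones. -/
theorem isCompactOperator_fluxMonomial_sub (B : ℝ) (m : Site) (α β : ℝ) (n : Site) :
    IsCompactOperator ((fluxMonomial B m α n : LatticeOp) - (fluxMonomial B m β n : LatticeOp)) := by
  have h : ∀ j, (fluxShift B m α j, fluxShift B m β j) ∈ compactDiffSubgroup := fun j =>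
    mem_compactDiffSubgroup_iff.2 (isCompactOperator_fluxShift_sub B m α β j)
  have h2 := compactDiffSubgroup.mul_mem (compactDiffSubgroup.zpow_mem (h 0) n.1)
    (compactDiffSubgroup.zpow_mem (h 1) n.2)
  rw [mem_compactDiffSubgroup_iff, Prod.fst_mul, Prod.snd_mul, Prod.pow_fst, Prod.pow_fst,
    Prod.pow_snd, Prod.pow_snd] at h2
  exact h2

/-- The gauge is linear in `α`, so conjugation by the Dirac phase adds exactly the gauge of one flux
quantum. -/
theorem semiconjBy_diracF (B : ℝ) (m : Site) (α : ℝ) (j : Fin 2) :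
    SemiconjBy (diracF m) (fluxShift B m α j) (fluxShift B m (α + 1) j) := by
  ext f n
  change (diracPhase m n : ℂ) * ((Circle.exp (-(symGauge B j n + abGauge m α j n)) : ℂ) *
    f (n + unitVec j)) = (Circle.exp (-(symGauge B j n + abGauge m (α + 1) j n)) : ℂ) *
      ((diracPhase m (n + unitVec j) : ℂ) * f (n + unitVec j))
  have h : diracPhase m n * Circle.exp (-(symGauge B j n + abGauge m α j n)) =
      Circle.exp (-(symGauge B j n + abGauge m (α + 1) j n)) * diracPhase m (n + unitVec j) := by
    rw [diracPhase_eq m j n, mul_right_comm, ← Circle.exp_add, abGauge_eq_mul m α,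
      abGauge_eq_mul m (α + 1)]
    congr 2
    ring
  rw [← mul_assoc, ← mul_assoc, ← Circle.coe_mul, ← Circle.coe_mul, h]

theorem diracF_mul_star_self (m : Site) :
    (diracF m : LatticeOp) * star (diracF m : LatticeOp) = 1 :=
  Unitary.coe_mul_star_self _

theorem diracF_conj_fluxMonomial (B : ℝ) (m : Site) (α : ℝ) (n : Site) :
    (diracF m : LatticeOp) * (fluxMonomial B m α n : LatticeOp) * star (diracF m : LatticeOp) =
      (fluxMonomial B m (α + 1) n : LatticeOp) := by
  have h : SemiconjBy (diracF m) (fluxMonomial B m α n) (fluxMonomial B m (α + 1) n) :=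
    ((semiconjBy_diracF B m α 0).zpow_right n.1).mul_right
      ((semiconjBy_diracF B m α 1).zpow_right n.2)
  have h' : (diracF m : LatticeOp) * (fluxMonomial B m α n : LatticeOp) =
      (fluxMonomial B m (α + 1) n : LatticeOp) * (diracF m : LatticeOp) :=
    congrArg Subtype.val h.eq
  rw [h', mul_assoc, diracF_mul_star_self, mul_one]

/-! ### The Hamiltonians -/

section Hamiltonian

variable {B : ℝ} {m : Site} {t : Site → ℝ → LatticeOp}

theorem norm_mul_unitary_le (A : LatticeOp) (U : unitary LatticeOp) :
    ‖A * (U : LatticeOp)‖ ≤ ‖A‖ :=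
  (CStarRing.norm_mul_coe_unitary A U).le

theorem IsHopping.summable_mul (ht : IsHopping B m t) (α β : ℝ) :
    Summable fun n => t n α * (fluxMonomial B m β n : LatticeOp) :=
  Summable.of_norm_bounded (ht.summable α) fun _ => norm_mul_unitary_le _ _

theorem IsHopping.tendsto_tsum_sub_mul (ht : IsHopping B m t) (α₀ : ℝ) :
    Tendsto (fun α => ∑' n, (t n α - t n α₀) * (fluxMonomial B m α n : LatticeOp)) (𝓝 α₀)
      (𝓝 0) := by
  have hs : ∀ α, Summable fun n => ‖t n α - t n α₀‖ := fun α =>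
    Summable.of_nonneg_of_le (fun _ => norm_nonneg _) (fun _ => norm_sub_le _ _)
      ((ht.summable α).add (ht.summable α₀))
  refine squeeze_zero_norm (fun α => ?_) (ht.continuous α₀)
  exact tsum_of_norm_bounded (hs α).hasSum fun n => norm_mul_unitary_le _ _

/-- The change of the amplitudes is small in the summable norm, uniformly in the unitaries; with
amplitudes frozen at `α₀`, dominated convergence applies. -/
theorem IsHopping.continuous_tsum (ht : IsHopping B m t) :
    Continuous fun α => ∑' n, t n α * (fluxMonomial B m α n : LatticeOp) := by
  refine continuous_iff_continuousAt.2 fun α₀ => ?_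
  have h1 := ht.tendsto_tsum_sub_mul α₀
  have h2 : Tendsto (fun α => ∑' n, t n α₀ * (fluxMonomial B m α n : LatticeOp)) (𝓝 α₀)
      (𝓝 (∑' n, t n α₀ * (fluxMonomial B m α₀ n : LatticeOp))) := by
    refine tendsto_tsum_of_dominated_convergence (ht.summable α₀) (fun n => ?_)
      (Eventually.of_forall fun α n => norm_mul_unitary_le _ _)
    exact ((continuous_fluxMonomial B m n).tendsto α₀).const_mul _
  have h3 := h1.add h2
  rw [zero_add] at h3
  refine h3.congr fun α => ?_
  have hs := (ht.summable_mul α α).sub (ht.summable_mul α₀ α)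
  simp only [← sub_mul] at hs
  rw [← hs.tsum_add (ht.summable_mul α₀ α)]
  refine tsum_congr fun n => ?_
  rw [← add_mul, sub_add_cancel]

/-- The symmetry imposed on `t_{-n}` is what pairs the terms `n` and `-n`, so that the substitution
`n ↦ -n` shows the sum to be self-adjoint. -/
theorem IsHopping.star_term (ht : IsHopping B m t) (α : ℝ) (n : Site) :
    star (t n α * (fluxMonomial B m α n : LatticeOp)) =
      t (-n) α * (fluxMonomial B m α (-n) : LatticeOp) := by
  have h1 : (fluxShift B m α 1 ^ n.2 * fluxShift B m α 0 ^ n.1) * fluxMonomial B m α (-n) = 1 := by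
    simp only [fluxMonomial, Prod.fst_neg, Prod.snd_neg, zpow_neg]
    group
  have h2 : star (fluxMonomial B m α n) =
      fluxShift B m α 1 ^ (-n.2) * fluxShift B m α 0 ^ (-n.1) := by
    rw [Unitary.star_eq_inv, fluxMonomial, mul_inv_rev, zpow_neg, zpow_neg]
  have h3 : ((fluxShift B m α 1 ^ n.2 * fluxShift B m α 0 ^ n.1 : unitary LatticeOp) : LatticeOp) *
      (fluxMonomial B m α (-n) : LatticeOp) = 1 := congrArg Subtype.val h1
  have h4 : star (fluxMonomial B m α n : LatticeOp) =
      ((fluxShift B m α 1 ^ (-n.2) * fluxShift B m α 0 ^ (-n.1) : unitary LatticeOp) :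
        LatticeOp) := congrArg Subtype.val h2
  rw [ht.selfAdjoint n α, star_mul, mul_assoc, h3, mul_one, h4]

theorem isSelfAdjoint_potential (v : Site → ℝ) (hv : ∃ C, ∀ n, |v n| ≤ C) :
    IsSelfAdjoint (potential v hv) := by
  rw [ContinuousLinearMap.isSelfAdjoint_iff_isSymmetric]
  intro f g
  change inner ℂ (potential v hv f) g = inner ℂ f (potential v hv g)
  rw [lp.inner_eq_tsum, lp.inner_eq_tsum]
  refine tsum_congr fun n => ?_
  simp only [potential_apply, RCLike.inner_apply, map_mul, Complex.conj_ofReal]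
  ring

theorem IsHopping.isSelfAdjoint_hamiltonian (ht : IsHopping B m t) (v : Site → ℝ)
    (hv : ∃ C, ∀ n, |v n| ≤ C) (α lam : ℝ) : IsSelfAdjoint (hamiltonian B m t v hv α lam) := by
  have h1 : star (∑' n, t n α * (fluxMonomial B m α n : LatticeOp)) =
      ∑' n, t n α * (fluxMonomial B m α n : LatticeOp) := by
    rw [tsum_star]
    simp only [ht.star_term]
    exact (Equiv.neg Site).tsum_eq fun n => t n α * (fluxMonomial B m α n : LatticeOp)
  have h2 : star ((lam : ℂ) • potential v hv) = (lam : ℂ) • potential v hv := by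
    rw [star_smul, (isSelfAdjoint_potential v hv).star_eq, Complex.star_def, Complex.conj_ofReal]
  rw [IsSelfAdjoint, hamiltonian, star_add, h1, h2]

theorem IsHopping.continuous_hamiltonian (ht : IsHopping B m t) (v : Site → ℝ)
    (hv : ∃ C, ∀ n, |v n| ≤ C) (lam : ℝ) : Continuous fun α => hamiltonian B m t v hv α lam :=
  ht.continuous_tsum.add continuous_const

theorem IsHopping.isCompactOperator_term_sub (ht : IsHopping B m t) (α β : ℝ) (n : Site) :
    IsCompactOperator (t n α * (fluxMonomial B m α n : LatticeOp) -
      t n β * (fluxMonomial B m β n : LatticeOp)) := by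
  obtain ⟨c, hc⟩ := ht.compact n
  -- The same scalar `c` serves both fluxes, so the non-compact part enters only through a
  -- difference of monomials.
  have e : t n α * (fluxMonomial B m α n : LatticeOp) - t n β * (fluxMonomial B m β n : LatticeOp) =
      ((t n α - c • 1) * (fluxMonomial B m α n : LatticeOp) -
        (t n β - c • 1) * (fluxMonomial B m β n : LatticeOp)) +
        c • ((fluxMonomial B m α n : LatticeOp) - (fluxMonomial B m β n : LatticeOp)) := by
    rw [sub_mul, sub_mul, smul_mul_assoc, smul_mul_assoc, one_mul, one_mul, smul_sub]
    abel
  rw [e]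
  exact (((hc α).mul_right _).sub ((hc β).mul_right _)).add
    ((isCompactOperator_fluxMonomial_sub B m α β n).smul c)

theorem IsHopping.isCompactOperator_hamiltonian_sub (ht : IsHopping B m t) (v : Site → ℝ)
    (hv : ∃ C, ∀ n, |v n| ≤ C) (α β lam : ℝ) :
    IsCompactOperator (hamiltonian B m t v hv α lam - hamiltonian B m t v hv β lam) := by
  have e : hamiltonian B m t v hv α lam - hamiltonian B m t v hv β lam =
      ∑' n, (t n α * (fluxMonomial B m α n : LatticeOp) -
        t n β * (fluxMonomial B m β n : LatticeOp)) := by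
    rw [hamiltonian, hamiltonian, add_sub_add_right_eq_sub,
      (ht.summable_mul α α).tsum_sub (ht.summable_mul β β)]
  rw [e]
  have hcl := isClosed_setOfPred_isCompactOperator (𝕜₁ := ℂ) (σ₁₂ := RingHom.id ℂ)
    (M₁ := L2Lattice) (M₂ := L2Lattice)
  -- Finite partial sums are compact, and the series converges in norm.
  refine hcl.mem_of_tendsto ((ht.summable_mul α α).sub (ht.summable_mul β β)).hasSum
    (Eventually.of_forall fun s => ?_)
  exact (compactOperator (RingHom.id ℂ) L2Lattice L2Lattice).sum_mem
    fun n _ => ht.isCompactOperator_term_sub α β n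

theorem diracF_conj_potential (m : Site) (v : Site → ℝ) (hv : ∃ C, ∀ n, |v n| ≤ C) :
    (diracF m : LatticeOp) * potential v hv * star (diracF m : LatticeOp) = potential v hv := by
  have h : (diracF m : LatticeOp) * potential v hv = potential v hv * (diracF m : LatticeOp) := by
    ext f n
    change (diracPhase m n : ℂ) * ((v n : ℂ) * f n) = (v n : ℂ) * ((diracPhase m n : ℂ) * f n)
    ring
  rw [h, mul_assoc, diracF_mul_star_self, mul_one]

theorem IsHopping.diracF_conj_hamiltonian (ht : IsHopping B m t) (v : Site → ℝ)
    (hv : ∃ C, ∀ n, |v n| ≤ C) (α lam : ℝ) :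
    (diracF m : LatticeOp) * hamiltonian B m t v hv α lam * star (diracF m : LatticeOp) =
      hamiltonian B m t v hv (α + 1) lam := by
  have hF : ∀ A C : LatticeOp, (diracF m : LatticeOp) * (A * C) * star (diracF m : LatticeOp) =
      ((diracF m : LatticeOp) * A * star (diracF m : LatticeOp)) *
        ((diracF m : LatticeOp) * C * star (diracF m : LatticeOp)) := by
    intro A C
    have h : star (diracF m : LatticeOp) * (diracF m : LatticeOp) = 1 :=
      Unitary.coe_star_mul_self _
    simp only [mul_assoc]
    rw [← mul_assoc (star (diracF m : LatticeOp)) (diracF m : LatticeOp), h, one_mul]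
  rw [hamiltonian, mul_add, add_mul, mul_smul_comm, smul_mul_assoc, diracF_conj_potential,
    ← (ht.summable_mul α α).tsum_mul_left, ← ((ht.summable_mul α α).mul_left _).tsum_mul_right]
  simp only [hF, ht.covariant, diracF_conj_fluxMonomial]
  rfl

end Hamiltonian

theorem mainTheorem1 (B : ℝ) (m : Site) (t : Site → ℝ → LatticeOp) (ht : IsHopping B m t)
    (v : Site → ℝ) (hv : ∃ C, ∀ n, |v n| ≤ C) (μ : ℝ) (hgap : GapHypothesis B m t v hv μ) :
    (∀ lam ∈ Set.Icc (0 : ℝ) 1,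
      (compression (fermiProj B m t v hv μ lam) (diracF m : LatticeOp)).IsFredholm ∧
      HasSpectralFlow (fun α => hamiltonian B m t v hv α lam) μ
        (-fredholmIndex (compression (fermiProj B m t v hv μ lam) (diracF m : LatticeOp)))) ∧
    ∀ lam₁ ∈ Set.Icc (0 : ℝ) 1, ∀ lam₂ ∈ Set.Icc (0 : ℝ) 1,
      fredholmIndex (compression (fermiProj B m t v hv μ lam₁) (diracF m : LatticeOp)) =
        fredholmIndex (compression (fermiProj B m t v hv μ lam₂) (diracF m : LatticeOp)) := by
  have hconj : ∀ lam, hamiltonian B m t v hv 1 lam =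
      (diracF m : LatticeOp) * hamiltonian B m t v hv 0 lam * star (diracF m : LatticeOp) := by
    intro lam
    rw [ht.diracF_conj_hamiltonian, zero_add]
  have hcomp : ∀ lam, IsCompactOperator ((diracF m : LatticeOp) * hamiltonian B m t v hv 0 lam *
      star (diracF m : LatticeOp) - hamiltonian B m t v hv 0 lam) := by
    intro lam
    rw [← hconj]
    exact ht.isCompactOperator_hamiltonian_sub v hv 1 0 lam
  refine ⟨fun lam hlam => ⟨?_, ?_⟩, fun lam₁ h₁ lam₂ h₂ => ?_⟩
  · exact isFredholm_compression (ht.isSelfAdjoint_hamiltonian v hv 0 lam) (hcomp lam)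
      (hgap.2 lam hlam)
  · exact hasSpectralFlow_of_unitary_conj (T := fun α => hamiltonian B m t v hv α lam)
      (ht.continuous_hamiltonian v hv lam) (fun α => ht.isSelfAdjoint_hamiltonian v hv α lam)
      (fun α => ht.isCompactOperator_hamiltonian_sub v hv α 0 lam) (hconj lam) (hgap.2 lam hlam)
  · have hcont : Continuous fun lam => hamiltonian B m t v hv 0 lam :=
      continuous_const.add (Complex.continuous_ofReal.smul continuous_const)
    -- A continuous integer-valued function on a connected set is constant.
    exact isPreconnected_Icc.constant (continuousOn_index_compression hcont
      (fun lam => ht.isSelfAdjoint_hamiltonian v hv 0 lam) hcomp hgap.2) h₁ h₂
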